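/- **Proposition 2.1.** For $\alpha,\beta>0$ and $f:(0,\infty)\times[0,1]\to\mathbb{R}$ let $$\|f\|_{\mathscr{C}_\infty(\alpha,\beta)}=\sup_{t>0,\,x\in[0,1]} t^{\alpha}\mathrm{e}^{-\beta t}|f(t,x)|\in[0,\infty],$$ and let $\mathscr{C}_\infty(\alpha,\beta)$ be the space of all continuous $f:(0,\infty)\times[0,1]\to\mathbb{R}$ with $\|f\|_{\mathscr{C}_\infty(\alpha,\beta)}<\infty$. For a random field $X=\{X(t,x)\}_{t>0,\,x\in[0,1]}$ on a probability space and $k\ge 1$ let $$\mathcal{N}_{k,\alpha,\beta,\infty}(X)=\sup_{t>0,\,x\in[0,1]} t^{\alpha}\mathrm{e}^{-\beta t}\|X(t,x)\|_k\in[0,\infty],\qquad \|Z\|_k=\mathrm{E}(|Z|^k)^{1/k}.$$ Fix real numbers $\alpha>0$, $\beta\ge1$, $\tau,\mu\in(0,1)$ and $k\ge 4(\tau^{-1}+\mu^{-1})$, and let $X=\{X(t,x)\}_{t>0,\,x\in[0,1]}$ be a real-valued random field such that $$C=\sup_{\varepsilon\in(0,1)}\ \sup_{t>0}\ \sup_{0\le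 x<y\le1}\left(\frac{t^{\alpha}\mathrm{e}^{-\beta t}\,\|X(t+\varepsilon,x)-X(t,y)\|_k}{\varepsilon^{\tau}\vee|x-y|^{\mu}}\right)<\infty.$$ Then $X$ has a modification all of whose sample functions are continuous on $(0,\infty)\times[0,1]$. Moreover, let $Y$ be any modification of $X$ whose sample functions are almost surely continuous on $(0,\infty)\times[0,1]$ (for example $Y=X$, if $X$ is almost surely continuous). Then, for all $\bar\alpha>\alpha$ and $\bar\beta>\beta$, we have $Y\in\mathscr{C}_\infty(\bar\alpha,\bar\beta)$ almost surely and $$\mathrm{E}\left(\|Y\|_{\mathscr{C}_\infty(\bar\alpha,\bar\beta)}^k\right)\le(1280L)^k\left[\mathcal{N}_{k,\alpha,\beta,\infty}(X)+C\right]^k,$$ where $$L=L(\alpha,\bar\alpha,\beta,\bar\beta)=\max\left(\frac{2^{\bar\alpha}}{2^{\bar\alpha-\alpha}-1}\,,\ \sum_{n=0}^\infty(n+1)^{\bar\alpha+\alpha}\,\mathrm{e}^{-n(\bar\beta-\beta)/\beta}\right).$$ -/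

import Mathlib

open MeasureTheory Set
open scoped ENNReal

namespace SpaceTimeField

/-- The space-time domain `𝒟(∞) = (0, ∞) × [0, 1]`. -/
def domain : Set (ℝ × ℝ) := Ioi (0 : ℝ) ×ˢ Icc (0 : ℝ) 1

/-- The norm `sup_{(t,x) ∈ 𝒟(∞)} t^α e^{-β t} |f(t, x)|`, with values in `[0, ∞]`. -/
noncomputable def weightedSupNorm (α β : ℝ) (f : ℝ → ℝ → ℝ) : ℝ≥0∞ :=
  ⨆ p ∈ domain, ENNReal.ofReal (p.1 ^ α * Real.exp (-β * p.1) * |f p.1 p.2|)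

/-- Membership in the space `𝒞_∞(α, β)`: continuity on `𝒟(∞)` and a finite weighted norm. -/
def MemWeightedC (α β : ℝ) (f : ℝ → ℝ → ℝ) : Prop :=
  ContinuousOn (fun p : ℝ × ℝ => f p.1 p.2) domain ∧ weightedSupNorm α β f < ∞

variable {Ω : Type*} [MeasurableSpace Ω]

/-- `𝒩_{k,α,β,∞}(X) = sup_{(t,x) ∈ 𝒟(∞)} t^α e^{-β t} ‖X(t, x)‖_k`, with values in `[0, ∞]`. -/
noncomputable def momentNorm (P : Measure Ω) (k α β : ℝ) (X : ℝ → ℝ → Ω → ℝ) : ℝ≥0∞ :=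
  ⨆ p ∈ domain, ENNReal.ofReal (p.1 ^ α * Real.exp (-β * p.1)) *
    eLpNorm (X p.1 p.2) (ENNReal.ofReal k) P

/-- The weighted Hölder constant of the `L^k(Ω)`-increments: the supremum over `ε ∈ (0, 1)`,
`t > 0` and `0 ≤ x < y ≤ 1` of
`t^α e^{-β t} ‖X(t + ε, x) - X(t, y)‖_k / (ε^τ ∨ |x - y|^μ)`, with values in `[0, ∞]`. -/
noncomputable def incrementConst (P : Measure Ω) (k α β τ μ : ℝ) (X : ℝ → ℝ → Ω → ℝ) : ℝ≥0∞ :=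
  ⨆ (ε : ℝ) (_ : ε ∈ Ioo (0 : ℝ) 1) (t : ℝ) (_ : 0 < t)
    (x : ℝ) (y : ℝ) (_ : 0 ≤ x ∧ x < y ∧ y ≤ 1),
    ENNReal.ofReal (t ^ α * Real.exp (-β * t)) *
      eLpNorm (fun ω => X (t + ε) x ω - X t y ω) (ENNReal.ofReal k) P /
      ENNReal.ofReal (max (ε ^ τ) (|x - y| ^ μ))

/-- `Y` is a modification of `X` on `𝒟(∞)`. -/
def IsModification (P : Measure Ω) (X Y : ℝ → ℝ → Ω → ℝ) : Prop :=
  ∀ p ∈ domain, Y p.1 p.2 =ᵐ[P] X p.1 p.2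

/-- The constant `L(α, α', β, β')`. -/
noncomputable def constL (α α' β β' : ℝ) : ℝ :=
  max ((2 : ℝ) ^ α' / ((2 : ℝ) ^ (α' - α) - 1))
    (∑' n : ℕ, ((n : ℝ) + 1) ^ (α' + α) * Real.exp (-(n : ℝ) * (β' - β) / β))

end SpaceTimeField

namespace SpaceTimeField

open Filter Topology

/-! The proof is Kolmogorov chaining on bounded time blocks, followed by a weighted summation over
blocks that exhaust the time axis.

The hypothesis controls an increment only when the later point has the strictly smaller space
coordinate. Detours through auxiliary points and a limit remove this restriction
(`incSize_le_of_le`, `incSize_block_le`): on a block of length at most one, `X` is Hölder in `L^k`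
for the anisotropic distance, with constant `4 * C * W`, where `W` bounds `t^(-α) e^(β t)` on the
block.

On such a block use grids whose meshes `ε`, `η` satisfy `ε^τ, η^μ ≤ 2^(-j)`. Since `k ≥ 4 (τ⁻¹ +
μ⁻¹)`, the number of links at level `j`, raised to the power `1/k`, is at most `4 (3/2)^j`, while
each linked increment has `L^k` size of order `2^(-j)`. The product decays like `(3/4)^j`, so the
chain converges to a continuous modification whose deviation from its value at a corner has a
measurable majorant in `L^k` (`exists_block_modification`). Block versions over countably many
rational intervals agree almost surely on overlaps, and glue to `exists_continuous_modification`.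

For the norm, cover the time axis by dyadic blocks in `(0, 1/β]` and blocks of length `1/β` beyond.
The gaps `α' - α` and `β' - β` make weight times growth summable, with sums governed by `constL`.
The resulting `exists_majorant` bounds `Y - Z₀` for a reference variable `Z₀`, and is applied twice:
`Z₀ = X 1 0` gives almost sure finiteness even if the moment norm is infinite, and `Z₀ = 0` gives
the moment bound. -/

/-- The `L^k` size of a nonnegative function, with values in `[0, ∞]`. -/
noncomputable def lpSize {Ω : Type*} [MeasurableSpace Ω] (P : Measure Ω) (k : ℝ)
    (f : Ω → ℝ≥0∞) : ℝ≥0∞ :=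
  (∫⁻ ω, f ω ^ k ∂P) ^ (1 / k)

/-! ### Minkowski and monotone convergence for the `L^k` size. -/

section LpSize

variable {Ω : Type*} [MeasurableSpace Ω] {P : Measure Ω} {k : ℝ}

theorem lintegral_rpow_le_of_lpSize_le (hk : 0 < k) {f : Ω → ℝ≥0∞} {a : ℝ≥0∞}
    (h : lpSize P k f ≤ a) : ∫⁻ ω, f ω ^ k ∂P ≤ a ^ k := by
  have := ENNReal.rpow_le_rpow h hk.le
  rwa [lpSize, ← ENNReal.rpow_mul, one_div_mul_cancel hk.ne', ENNReal.rpow_one] at this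

theorem lpSize_le_of_lintegral_rpow_le (hk : 0 < k) {f : Ω → ℝ≥0∞} {a : ℝ≥0∞}
    (h : ∫⁻ ω, f ω ^ k ∂P ≤ a ^ k) : lpSize P k f ≤ a := by
  have := ENNReal.rpow_le_rpow h (one_div_nonneg.2 hk.le)
  rwa [← ENNReal.rpow_mul, mul_one_div_cancel hk.ne', ENNReal.rpow_one] at this

theorem eLpNorm_eq_lpSize (hk : 0 < k) (f : Ω → ℝ) :
    eLpNorm f (ENNReal.ofReal k) P = lpSize P k (fun ω => ‖f ω‖ₑ) := by
  rw [eLpNorm_eq_lintegral_rpow_enorm_toReal (by simpa using hk) ENNReal.ofReal_ne_top,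
    ENNReal.toReal_ofReal hk.le, lpSize]

theorem lpSize_add_le (hk : 1 ≤ k) {f g : Ω → ℝ≥0∞} (hf : Measurable f) (hg : Measurable g) :
    lpSize P k (fun ω => f ω + g ω) ≤ lpSize P k f + lpSize P k g :=
  ENNReal.lintegral_Lp_add_le hf.aemeasurable hg.aemeasurable hk

theorem lpSize_const_mul (hk : 0 < k) (a : ℝ≥0∞) {f : Ω → ℝ≥0∞} (hf : Measurable f) :
    lpSize P k (fun ω => a * f ω) = a * lpSize P k f := by
  simp only [lpSize, ENNReal.mul_rpow_of_nonneg _ _ hk.le]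
  rw [lintegral_const_mul _ (hf.pow_const k), ENNReal.mul_rpow_of_nonneg _ _ (by positivity),
    ← ENNReal.rpow_mul, mul_one_div_cancel hk.ne', ENNReal.rpow_one]

theorem lpSize_sum_le (hk : 1 ≤ k) {f : ℕ → Ω → ℝ≥0∞} (hf : ∀ n, Measurable (f n)) (n : ℕ) :
    lpSize P k (fun ω => ∑ i ∈ Finset.range n, f i ω) ≤
      ∑ i ∈ Finset.range n, lpSize P k (f i) := by
  have hk0 : 0 < k := by linarith
  induction n with
  | zero => simp [lpSize, ENNReal.zero_rpow_of_pos hk0, hk0]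
  | succ n ih =>
    simp only [Finset.sum_range_succ]
    refine (lpSize_add_le hk (by fun_prop) (hf n)).trans ?_
    gcongr

theorem lpSize_tsum_le (hk : 1 ≤ k) {f : ℕ → Ω → ℝ≥0∞} (hf : ∀ n, Measurable (f n)) :
    lpSize P k (fun ω => ∑' i, f i ω) ≤ ∑' i, lpSize P k (f i) := by
  have hk0 : 0 < k := by linarith
  refine lpSize_le_of_lintegral_rpow_le hk0 ?_
  have hlim : Tendsto (fun n => ∫⁻ ω, (∑ i ∈ Finset.range n, f i ω) ^ k ∂P) atTop
      (𝓝 (∫⁻ ω, (∑' i, f i ω) ^ k ∂P)) := by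
    refine lintegral_tendsto_of_tendsto_of_monotone (fun n => by fun_prop) ?_ ?_
    · refine ae_of_all _ fun ω n m hnm => ?_
      have : ∑ i ∈ Finset.range n, f i ω ≤ ∑ i ∈ Finset.range m, f i ω :=
        Finset.sum_le_sum_of_subset (Finset.range_mono hnm)
      exact ENNReal.rpow_le_rpow this hk0.le
    · exact ae_of_all _ fun ω =>
        (ENNReal.continuous_rpow_const.tendsto _).comp (ENNReal.tendsto_nat_tsum _)
  refine le_of_tendsto' hlim fun n => lintegral_rpow_le_of_lpSize_le hk0 ?_
  exact (lpSize_sum_le hk hf n).trans (ENNReal.sum_le_tsum _)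

theorem ae_lt_top_of_lpSize (hk : 0 < k) {f : Ω → ℝ≥0∞} (hf : Measurable f)
    (h : lpSize P k f < ∞) : ∀ᵐ ω ∂P, f ω < ∞ := by
  have h1 : ∫⁻ ω, f ω ^ k ∂P ≠ ∞ :=
    ((lintegral_rpow_le_of_lpSize_le hk le_rfl).trans_lt (ENNReal.rpow_lt_top_of_nonneg hk.le h.ne)).ne
  filter_upwards [ae_lt_top (hf.pow_const k) h1] with ω hω
  exact (ENNReal.rpow_lt_top_iff_of_pos hk).1 hω

end LpSize

/-! ### Abstract chaining. -/

/-- Chaining along approximating points `π j p` linked by finite sets of pairs: the limit of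
`Z (π j p)` is a continuous modification of `Z`, controlled by an `L^k` majorant. -/
theorem exists_continuous_modification_of_chaining {Ω : Type*} [MeasurableSpace Ω] {P : Measure Ω}
    {k : ℝ} (hk : 1 ≤ k) {T : Type*} [TopologicalSpace T] (S : Set T) (Z : T → Ω → ℝ)
    (hZ : ∀ p ∈ S, Measurable (Z p)) (π : ℕ → T → T) (hπ : ∀ j, ∀ p ∈ S, π j p ∈ S)
    (E : ℕ → Finset (T × T)) (hE : ∀ j, ∀ e ∈ E j, e.1 ∈ S ∧ e.2 ∈ S)
    (δ : ℕ → ℝ≥0∞)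
    (hlink : ∀ p ∈ S, ∀ j, (π j p, π (j + 1) p) ∈ E j)
    (hδ : ∀ j, ∀ e ∈ E j, lpSize P k (fun ω => ‖Z e.1 ω - Z e.2 ω‖ₑ) ≤ δ j)
    (happrox : ∀ p ∈ S, Tendsto (fun j => lpSize P k (fun ω => ‖Z (π j p) ω - Z p ω‖ₑ)) atTop (𝓝 0))
    (hnear : ∀ j, ∀ p ∈ S, ∀ᶠ q in 𝓝[S] p, (π j p, π (j + 1) q) ∈ E j)
    (hsum : ∑' j, ((E j).card : ℝ≥0∞) ^ (1 / k) * δ j < ∞) :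
    ∃ (Y : T → Ω → ℝ) (R : Ω → ℝ≥0∞), (∀ p ∈ S, Measurable (Y p)) ∧ Measurable R ∧
      (∀ p ∈ S, Y p =ᵐ[P] Z p) ∧ (∀ ω, ContinuousOn (fun p => Y p ω) S) ∧
      lpSize P k R ≤ ∑' j, ((E j).card : ℝ≥0∞) ^ (1 / k) * δ j ∧
      ∀ p₀ ∈ S, ∀ p ∈ S, (p₀, π 1 p) ∈ E 0 → ∀ ω, ‖Y p ω - Z p₀ ω‖ₑ ≤ R ω := by
  have hk0 : 0 < k := by linarith
  -- The `ℓ^k` sum dominates the maximum over the links of level `j`, and its `k`-th moment is just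
  -- a sum of moments; this costs the factor `card^(1/k)`.
  let M : ℕ → Ω → ℝ≥0∞ := fun j ω => (∑ e ∈ E j, ‖Z e.1 ω - Z e.2 ω‖ₑ ^ k) ^ (1 / k)
  have hmeasd : ∀ j, ∀ e ∈ E j, Measurable fun ω => ‖Z e.1 ω - Z e.2 ω‖ₑ ^ k := fun j e he =>
    (((hZ _ (hE j e he).1).sub (hZ _ (hE j e he).2)).enorm).pow_const k
  have hMmeas : ∀ j, Measurable (M j) := fun j =>
    (Finset.measurable_fun_sum _ (hmeasd j)).pow_const _
  have hM : ∀ j, ∀ e ∈ E j, ∀ ω, ‖Z e.1 ω - Z e.2 ω‖ₑ ≤ M j ω := by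
    intro j e he ω
    have h1 : ‖Z e.1 ω - Z e.2 ω‖ₑ ^ k ≤ ∑ e ∈ E j, ‖Z e.1 ω - Z e.2 ω‖ₑ ^ k :=
      Finset.single_le_sum (f := fun e : T × T => ‖Z e.1 ω - Z e.2 ω‖ₑ ^ k)
        (fun _ _ => zero_le) he
    have := ENNReal.rpow_le_rpow h1 (one_div_nonneg.2 hk0.le)
    rwa [← ENNReal.rpow_mul, mul_one_div_cancel hk0.ne', ENNReal.rpow_one] at this
  have hMsize : ∀ j, lpSize P k (M j) ≤ ((E j).card : ℝ≥0∞) ^ (1 / k) * δ j := by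
    intro j
    refine lpSize_le_of_lintegral_rpow_le hk0 ?_
    have : ∀ ω, M j ω ^ k = ∑ e ∈ E j, ‖Z e.1 ω - Z e.2 ω‖ₑ ^ k := fun ω => by
      simp only [M]
      rw [← ENNReal.rpow_mul, one_div_mul_cancel hk0.ne', ENNReal.rpow_one]
    simp only [this]
    rw [lintegral_finsetSum _ (hmeasd j), ENNReal.mul_rpow_of_nonneg _ _ hk0.le, ← ENNReal.rpow_mul,
      one_div_mul_cancel hk0.ne', ENNReal.rpow_one, ← nsmul_eq_mul]
    exact Finset.sum_le_card_nsmul _ _ _ fun e he =>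
      lintegral_rpow_le_of_lpSize_le hk0 (hδ j e he)
  let R : Ω → ℝ≥0∞ := fun ω => ∑' j, M j ω
  have hRmeas : Measurable R := Measurable.tsum hMmeas
  have hRsize : lpSize P k R ≤ ∑' j, ((E j).card : ℝ≥0∞) ^ (1 / k) * δ j :=
    (lpSize_tsum_le hk hMmeas).trans (ENNReal.tsum_le_tsum hMsize)
  have hRfin : ∀ᵐ ω ∂P, R ω < ∞ := ae_lt_top_of_lpSize hk0 hRmeas (hRsize.trans_lt hsum)
  have hlimex : ∀ p ∈ S, ∀ ω, R ω < ∞ → ∃ y, Tendsto (fun j => Z (π j p) ω) atTop (𝓝 y) := by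
    intro p hp ω hω
    refine cauchySeq_tendsto_of_complete
      (cauchySeq_of_edist_le_of_tsum_ne_top (fun j => M j ω) (fun j => ?_) hω.ne)
    rw [edist_eq_enorm_sub]
    exact hM j _ (hlink p hp j) ω
  classical
  -- The value zero where `R` is infinite makes every sample function continuous, not just almost
  -- every one.
  let Y : T → Ω → ℝ := fun p ω =>
    if h : p ∈ S ∧ R ω < ∞ then (hlimex p h.1 ω h.2).choose else 0
  have hY : ∀ p ∈ S, ∀ ω, R ω < ∞ → Tendsto (fun j => Z (π j p) ω) atTop (𝓝 (Y p ω)) := by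
    intro p hp ω hω
    have h : p ∈ S ∧ R ω < ∞ := ⟨hp, hω⟩
    simp only [Y, dif_pos h]
    exact (hlimex p h.1 ω h.2).choose_spec
  have hY0 : ∀ p ω, ¬ R ω < ∞ → Y p ω = 0 := by
    intro p ω hω
    simp only [Y]
    exact dif_neg fun h => hω h.2
  have htail : ∀ p ∈ S, ∀ ω, R ω < ∞ → ∀ n, edist (Z (π n p) ω) (Y p ω) ≤ ∑' m, M (n + m) ω := by
    intro p hp ω hω n
    refine edist_le_tsum_of_edist_le_of_tendsto (fun j => M j ω) (fun j => ?_) (hY p hp ω hω) n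
    rw [edist_eq_enorm_sub]
    exact hM j _ (hlink p hp j) ω
  have hms : MeasurableSet {ω | R ω < ∞} := measurableSet_lt hRmeas measurable_const
  refine ⟨Y, R, ?_, hRmeas, ?_, ?_, hRsize, ?_⟩
  · intro p hp
    refine measurable_of_tendsto_metrizable
      (f := fun j => {ω | R ω < ∞}.indicator (Z (π j p)))
      (fun j => (hZ _ (hπ j p hp)).indicator hms) ?_
    rw [tendsto_pi_nhds]
    intro ω
    by_cases hω : R ω < ∞
    · simpa [indicator, hω] using hY p hp ω hω
    · simp [indicator, hω, hY0 p ω hω]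
  · intro p hp
    have hmem : ∀ j, AEStronglyMeasurable (Z (π j p)) P := fun j =>
      (hZ _ (hπ j p hp)).aestronglyMeasurable
    -- The chain converges to `Y p` almost surely and to `Z p` in `L^k`; an almost surely convergent
    -- subsequence identifies the limits.
    have h1 : TendstoInMeasure P (fun j => Z (π j p)) atTop (Z p) := by
      refine tendstoInMeasure_of_tendsto_eLpNorm (p := ENNReal.ofReal k) (by simpa using hk0)
        hmem (hZ p hp).aestronglyMeasurable ?_
      simpa only [eLpNorm_eq_lpSize hk0, Pi.sub_apply] using happrox p hp
    obtain ⟨ns, hns, hlim⟩ := h1.exists_seq_tendsto_ae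
    filter_upwards [hlim, hRfin] with ω h2 h3
    exact tendsto_nhds_unique ((hY p hp ω h3).comp hns.tendsto_atTop) h2
  · intro ω
    by_cases hω : R ω < ∞
    · intro p hp
      rw [ContinuousWithinAt, EMetric.tendsto_nhds]
      intro ε hε
      have hM0 : Tendsto (fun n => M n ω) atTop (𝓝 0) :=
        ENNReal.tendsto_atTop_zero_of_tsum_ne_top hω.ne
      have ht0 : Tendsto (fun n => ∑' m, M (n + m) ω) atTop (𝓝 0) := by
        simpa only [add_comm] using ENNReal.tendsto_sum_nat_add (fun n => M n ω) hω.ne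
      have ht1 : Tendsto (fun n => ∑' m, M (n + 1 + m) ω) atTop (𝓝 0) :=
        ht0.comp (tendsto_add_atTop_nat 1)
      have hall : Tendsto (fun n => ∑' m, M (n + 1 + m) ω + (M n ω + ∑' m, M (n + m) ω)) atTop
          (𝓝 0) := by
        simpa using ht1.add (hM0.add ht0)
      obtain ⟨n, hn⟩ := (hall.eventually (gt_mem_nhds hε)).exists
      -- Level `n` at `p` and level `n + 1` at a nearby `q` are joined by a single link, so the two
      -- tails and one term `M n` bound the oscillation.
      filter_upwards [hnear n p hp, self_mem_nhdsWithin] with q hq hqS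
      refine lt_of_le_of_lt ?_ hn
      calc edist (Y q ω) (Y p ω)
          ≤ edist (Y q ω) (Z (π (n + 1) q) ω) + edist (Z (π (n + 1) q) ω) (Z (π n p) ω)
            + edist (Z (π n p) ω) (Y p ω) := edist_triangle4 _ _ _ _
        _ ≤ ∑' m, M (n + 1 + m) ω + M n ω + ∑' m, M (n + m) ω := by
          gcongr
          · rw [edist_comm]; exact htail q hqS ω hω (n + 1)
          · rw [edist_comm, edist_eq_enorm_sub]; exact hM n _ hq ω
          · exact htail p hp ω hω n
        _ = _ := add_assoc _ _ _
    · simp only [hY0 _ ω hω]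
      exact continuousOn_const
  · intro p₀ _ p hp he ω
    by_cases hω : R ω < ∞
    · calc ‖Y p ω - Z p₀ ω‖ₑ = edist (Z p₀ ω) (Y p ω) := by
            rw [edist_comm, edist_eq_enorm_sub]
        _ ≤ edist (Z p₀ ω) (Z (π 1 p) ω) + edist (Z (π 1 p) ω) (Y p ω) := edist_triangle _ _ _
        -- The chain starts at level one because the link from the base point `p₀` already uses the
        -- level-zero term.
        _ ≤ M 0 ω + ∑' m, M (1 + m) ω := by
          gcongr
          · rw [edist_eq_enorm_sub]; exact hM 0 _ he ω
          · exact htail p hp ω hω 1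
        _ = R ω := by
          simp only [R, add_comm 1]
          exact (tsum_eq_zero_add' (f := fun j => M j ω) ENNReal.summable).symm
    · simp [not_lt_top_iff.1 hω]

/-! ### Dyadic grids and anisotropic levels. -/

/-- The largest dyadic number of level `m` below `s`. -/
noncomputable def dyadicFloor (m : ℕ) (s : ℝ) : ℝ := (⌊2 ^ m * s⌋₊ : ℝ) / 2 ^ m

/-- The dyadic numbers of level `m` in `[0, 1]`. -/
noncomputable def dyadicGrid (m : ℕ) : Finset ℝ :=
  (Finset.range (2 ^ m + 1)).image fun i : ℕ => (i : ℝ) / 2 ^ m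

theorem dyadicFloor_nonneg (m : ℕ) (s : ℝ) : 0 ≤ dyadicFloor m s := by
  unfold dyadicFloor; positivity

theorem dyadicFloor_le (m : ℕ) {s : ℝ} (hs : 0 ≤ s) : dyadicFloor m s ≤ s := by
  unfold dyadicFloor
  rw [div_le_iff₀ (by positivity), mul_comm s]
  exact Nat.floor_le (by positivity)

theorem sub_dyadicFloor_le (m : ℕ) (s : ℝ) : s - dyadicFloor m s ≤ (1 / 2) ^ m := by
  unfold dyadicFloor
  have h := (Nat.lt_floor_add_one (2 ^ m * s)).le
  rw [sub_le_iff_le_add, one_div, inv_pow, inv_eq_one_div, ← add_div, le_div_iff₀ (by positivity)]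
  linarith

theorem dyadicFloor_mem_grid (m : ℕ) {s : ℝ} (hs : s ∈ Icc (0 : ℝ) 1) :
    dyadicFloor m s ∈ dyadicGrid m := by
  refine Finset.mem_image.2 ⟨⌊2 ^ m * s⌋₊, ?_, rfl⟩
  rw [Finset.mem_range, Nat.lt_succ_iff]
  refine Nat.floor_le_of_le ?_
  push_cast
  nlinarith [hs.2, pow_pos (two_pos : (0 : ℝ) < 2) m]

theorem zero_mem_dyadicGrid (m : ℕ) : (0 : ℝ) ∈ dyadicGrid m :=
  Finset.mem_image.2 ⟨0, by simp, by simp⟩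

theorem dyadicGrid_subset (m : ℕ) {s : ℝ} (hs : s ∈ dyadicGrid m) : s ∈ Icc (0 : ℝ) 1 := by
  obtain ⟨i, hi, rfl⟩ := Finset.mem_image.1 hs
  refine ⟨by positivity, ?_⟩
  rw [div_le_one (by positivity)]
  rw [Finset.mem_range, Nat.lt_succ_iff] at hi
  exact_mod_cast hi

theorem card_dyadicGrid_le (m : ℕ) : (dyadicGrid m).card ≤ 2 ^ (m + 1) := by
  refine Finset.card_image_le.trans ?_
  rw [Finset.card_range, pow_succ]
  have := Nat.one_le_two_pow (n := m)
  omega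

theorem dyadicFloor_mem_Icc (m : ℕ) {s : ℝ} (hs : s ∈ Icc (0 : ℝ) 1) :
    dyadicFloor m s ∈ Icc (0 : ℝ) 1 :=
  ⟨dyadicFloor_nonneg m s, (dyadicFloor_le m hs.1).trans hs.2⟩

/-- Rounding errors are one-sided, so in either direction only one of them adds to the distance: two
meshes suffice instead of three. -/
theorem abs_dyadicFloor_sub_le {m m' : ℕ} (hm : m ≤ m') {s s' : ℝ} (hs : 0 ≤ s) (hs' : 0 ≤ s')
    (h : |s - s'| ≤ (1 / 2) ^ m) : |dyadicFloor m s - dyadicFloor m' s'| ≤ 2 * (1 / 2) ^ m := by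
  have h1 := dyadicFloor_le m hs
  have h2 := dyadicFloor_le m' hs'
  have h3 := sub_dyadicFloor_le m s
  have h4 := sub_dyadicFloor_le m' s'
  have h5 : ((1 : ℝ) / 2) ^ m' ≤ (1 / 2) ^ m :=
    pow_le_pow_of_le_one (by norm_num) (by norm_num) hm
  rw [abs_le] at h ⊢
  constructor <;> linarith

/-- The dyadic level whose mesh `ε` satisfies `ε ^ τ ≤ 2 ^ (-j)`. -/
noncomputable def meshLevel (τ : ℝ) (j : ℕ) : ℕ := ⌈(j : ℝ) * τ⁻¹⌉₊

theorem meshLevel_zero (τ : ℝ) : meshLevel τ 0 = 0 := by simp [meshLevel]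

theorem meshLevel_mono {τ : ℝ} (hτ : 0 < τ) : Monotone (meshLevel τ) := fun i j hij =>
  Nat.ceil_mono (by gcongr)

theorem meshLevel_le {τ : ℝ} (hτ : 0 < τ) (j : ℕ) : (meshLevel τ j : ℝ) ≤ j * τ⁻¹ + 1 :=
  (Nat.ceil_lt_add_one (by positivity)).le

theorem mesh_rpow_le {τ : ℝ} (hτ : 0 < τ) (j : ℕ) :
    (((1 : ℝ) / 2) ^ meshLevel τ j) ^ τ ≤ (1 / 2) ^ j := by
  rw [← Real.rpow_natCast, ← Real.rpow_mul (by norm_num), ← Real.rpow_natCast (1 / 2 : ℝ) j]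
  refine Real.rpow_le_rpow_of_exponent_ge (by norm_num) (by norm_num) ?_
  have : (j : ℝ) * τ⁻¹ ≤ meshLevel τ j := Nat.le_ceil _
  calc (j : ℝ) = j * τ⁻¹ * τ := by field_simp
    _ ≤ _ := by gcongr

theorem rpow_le_of_abs_le_two_mesh {τ : ℝ} (hτ : τ ∈ Ioo (0 : ℝ) 1) (j : ℕ) {x : ℝ} (hx : 0 ≤ x)
    (h : x ≤ 2 * (1 / 2) ^ meshLevel τ j) : x ^ τ ≤ 2 * (1 / 2) ^ j := by
  calc x ^ τ ≤ (2 * (1 / 2) ^ meshLevel τ j) ^ τ := Real.rpow_le_rpow hx h hτ.1.le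
    _ = 2 ^ τ * ((1 / 2) ^ meshLevel τ j) ^ τ := Real.mul_rpow (by norm_num) (by positivity)
    _ ≤ 2 * (1 / 2) ^ j := by
      gcongr
      · calc (2 : ℝ) ^ τ ≤ 2 ^ (1 : ℝ) :=
            Real.rpow_le_rpow_of_exponent_le (by norm_num) hτ.2.le
          _ = 2 := Real.rpow_one 2
      · exact mesh_rpow_le hτ.1 j

/-! ### Chaining on the unit square. -/

/-- The closed unit square. -/
def unitSquare : Set (ℝ × ℝ) := Icc (0 : ℝ) 1 ×ˢ Icc (0 : ℝ) 1

/-- Pairs of neighbouring grid points of two successive anisotropic levels. -/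
noncomputable def gridLinks (τ μ : ℝ) (j : ℕ) : Finset ((ℝ × ℝ) × (ℝ × ℝ)) :=
  ((dyadicGrid (meshLevel τ j) ×ˢ dyadicGrid (meshLevel μ j)) ×ˢ
    (dyadicGrid (meshLevel τ (j + 1)) ×ˢ dyadicGrid (meshLevel μ (j + 1)))).filter fun e =>
      |e.1.1 - e.2.1| ≤ 2 * (1 / 2) ^ meshLevel τ j ∧ |e.1.2 - e.2.2| ≤ 2 * (1 / 2) ^ meshLevel μ j

theorem mem_gridLinks {τ μ : ℝ} {j : ℕ} {e : (ℝ × ℝ) × (ℝ × ℝ)} :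
    e ∈ gridLinks τ μ j ↔
      ((e.1.1 ∈ dyadicGrid (meshLevel τ j) ∧ e.1.2 ∈ dyadicGrid (meshLevel μ j)) ∧
        e.2.1 ∈ dyadicGrid (meshLevel τ (j + 1)) ∧ e.2.2 ∈ dyadicGrid (meshLevel μ (j + 1))) ∧
      |e.1.1 - e.2.1| ≤ 2 * (1 / 2) ^ meshLevel τ j ∧
        |e.1.2 - e.2.2| ≤ 2 * (1 / 2) ^ meshLevel μ j := by
  simp only [gridLinks, Finset.mem_filter, Finset.mem_product]

/-- This is where the size of `k` enters. The four grids contribute exponents adding up to at most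
`(2j + 1)(τ⁻¹ + μ⁻¹) + 8`, hence at most `(j/2 + 2) k` because `k > 8`; finally `√2 ≤ 3/2`. -/
theorem card_gridLinks_rpow_le {τ μ k : ℝ} (hτ : τ ∈ Ioo (0 : ℝ) 1) (hμ : μ ∈ Ioo (0 : ℝ) 1)
    (hk : 4 * (τ⁻¹ + μ⁻¹) ≤ k) (j : ℕ) :
    ((gridLinks τ μ j).card : ℝ≥0∞) ^ (1 / k) ≤ ENNReal.ofReal (4 * (3 / 2) ^ j) := by
  have hτ1 : 1 < τ⁻¹ := (one_lt_inv₀ hτ.1).2 hτ.2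
  have hμ1 : 1 < μ⁻¹ := (one_lt_inv₀ hμ.1).2 hμ.2
  have hk8 : 8 < k := by linarith
  set N : ℕ := (meshLevel τ j + 1) + (meshLevel μ j + 1) +
    ((meshLevel τ (j + 1) + 1) + (meshLevel μ (j + 1) + 1)) with hN
  have hcard : (gridLinks τ μ j).card ≤ 2 ^ N := by
    refine (Finset.card_filter_le _ _).trans ?_
    rw [Finset.card_product, Finset.card_product, Finset.card_product, hN, pow_add, pow_add _ (_ + 1),
      pow_add _ (meshLevel τ (j + 1) + 1)]
    gcongr <;> exact card_dyadicGrid_le _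
  have hNle : (N : ℝ) ≤ ((j : ℝ) / 2 + 2) * k := by
    have h1 := meshLevel_le hτ.1 j
    have h2 := meshLevel_le hμ.1 j
    have h3 := meshLevel_le hτ.1 (j + 1)
    have h4 := meshLevel_le hμ.1 (j + 1)
    push_cast at h3 h4
    rw [hN]
    push_cast
    have h5 : (2 * (j : ℝ) + 1) * (τ⁻¹ + μ⁻¹) ≤ (2 * (j : ℝ) + 1) * (k / 4) := by
      gcongr; linarith
    nlinarith
  have hcard' : ((gridLinks τ μ j).card : ℝ≥0∞) ≤ ENNReal.ofReal (2 ^ (N : ℝ)) := by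
    rw [← ENNReal.ofReal_natCast]
    refine ENNReal.ofReal_le_ofReal ?_
    rw [Real.rpow_natCast]
    exact_mod_cast hcard
  calc ((gridLinks τ μ j).card : ℝ≥0∞) ^ (1 / k)
      ≤ ENNReal.ofReal (2 ^ (N : ℝ)) ^ (1 / k) :=
        ENNReal.rpow_le_rpow hcard' (by positivity)
    _ = ENNReal.ofReal (2 ^ ((N : ℝ) / k)) := by
        rw [ENNReal.ofReal_rpow_of_pos (by positivity), ← Real.rpow_mul (by norm_num),
          mul_one_div]
    _ ≤ ENNReal.ofReal (4 * (3 / 2) ^ j) := by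
        refine ENNReal.ofReal_le_ofReal ?_
        have h6 : (2 : ℝ) ^ ((1 : ℝ) / 2) ≤ 3 / 2 := by
          rw [← Real.sqrt_eq_rpow, Real.sqrt_le_left (by norm_num)]; norm_num
        calc (2 : ℝ) ^ ((N : ℝ) / k) ≤ 2 ^ ((1 : ℝ) / 2 * j + (2 : ℕ)) := by
              refine Real.rpow_le_rpow_of_exponent_le (by norm_num) ?_
              rw [div_le_iff₀ (by linarith)]
              push_cast
              linarith
          _ = 4 * (2 ^ ((1 : ℝ) / 2)) ^ j := by
              rw [Real.rpow_add (by norm_num), Real.rpow_mul (by norm_num), Real.rpow_natCast,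
                Real.rpow_natCast]
              ring
          _ ≤ 4 * (3 / 2) ^ j := by gcongr

/-- Level `j` contributes at most `4 (3/2)^j * 2 (1/2)^j * K = 8 (3/4)^j K`, and the geometric
series has sum `4`; hence the factor `32`. -/
theorem exists_continuous_modification_unitSquare {Ω : Type*} [MeasurableSpace Ω] {P : Measure Ω}
    {τ μ k : ℝ} (hτ : τ ∈ Ioo (0 : ℝ) 1) (hμ : μ ∈ Ioo (0 : ℝ) 1) (hk : 4 * (τ⁻¹ + μ⁻¹) ≤ k)
    (Z : ℝ × ℝ → Ω → ℝ) (hZ : ∀ p ∈ unitSquare, Measurable (Z p)) {K : ℝ≥0∞} (hK : K < ∞)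
    (hinc : ∀ p ∈ unitSquare, ∀ q ∈ unitSquare, lpSize P k (fun ω => ‖Z p ω - Z q ω‖ₑ) ≤
      K * ENNReal.ofReal (max (|p.1 - q.1| ^ τ) (|p.2 - q.2| ^ μ))) :
    ∃ (Y : ℝ × ℝ → Ω → ℝ) (R : Ω → ℝ≥0∞), (∀ p ∈ unitSquare, Measurable (Y p)) ∧ Measurable R ∧
      (∀ p ∈ unitSquare, Y p =ᵐ[P] Z p) ∧ (∀ ω, ContinuousOn (fun p => Y p ω) unitSquare) ∧
      lpSize P k R ≤ 32 * K ∧ ∀ p ∈ unitSquare, ∀ ω, ‖Y p ω - Z (0, 0) ω‖ₑ ≤ R ω := by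
  have hτ1 : 1 < τ⁻¹ := (one_lt_inv₀ hτ.1).2 hτ.2
  have hμ1 : 1 < μ⁻¹ := (one_lt_inv₀ hμ.1).2 hμ.2
  have hk1 : 1 ≤ k := by linarith
  let π : ℕ → ℝ × ℝ → ℝ × ℝ := fun j p =>
    (dyadicFloor (meshLevel τ j) p.1, dyadicFloor (meshLevel μ j) p.2)
  have hπ : ∀ j, ∀ p ∈ unitSquare, π j p ∈ unitSquare := fun j p hp =>
    ⟨dyadicFloor_mem_Icc _ hp.1, dyadicFloor_mem_Icc _ hp.2⟩
  have hE : ∀ j, ∀ e ∈ gridLinks τ μ j, e.1 ∈ unitSquare ∧ e.2 ∈ unitSquare := by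
    intro j e he
    obtain ⟨⟨⟨h1, h2⟩, h3, h4⟩, -⟩ := mem_gridLinks.1 he
    exact ⟨⟨dyadicGrid_subset _ h1, dyadicGrid_subset _ h2⟩,
      ⟨dyadicGrid_subset _ h3, dyadicGrid_subset _ h4⟩⟩
  have hmem : ∀ j, ∀ p ∈ unitSquare, ∀ q ∈ unitSquare, |p.1 - q.1| ≤ (1 / 2) ^ meshLevel τ j →
      |p.2 - q.2| ≤ (1 / 2) ^ meshLevel μ j → (π j p, π (j + 1) q) ∈ gridLinks τ μ j := by
    intro j p hp q hq h1 h2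
    refine mem_gridLinks.2 ⟨⟨⟨dyadicFloor_mem_grid _ hp.1, dyadicFloor_mem_grid _ hp.2⟩,
      dyadicFloor_mem_grid _ hq.1, dyadicFloor_mem_grid _ hq.2⟩, ?_, ?_⟩
    · exact abs_dyadicFloor_sub_le (meshLevel_mono hτ.1 (Nat.le_succ j)) hp.1.1 hq.1.1 h1
    · exact abs_dyadicFloor_sub_le (meshLevel_mono hμ.1 (Nat.le_succ j)) hp.2.1 hq.2.1 h2
  let δ : ℕ → ℝ≥0∞ := fun j => K * ENNReal.ofReal (2 * (1 / 2) ^ j)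
  have hterm : ∀ j, ((gridLinks τ μ j).card : ℝ≥0∞) ^ (1 / k) * δ j ≤
      8 * K * ENNReal.ofReal ((3 / 4) ^ j) := by
    intro j
    calc ((gridLinks τ μ j).card : ℝ≥0∞) ^ (1 / k) * δ j
        ≤ ENNReal.ofReal (4 * (3 / 2) ^ j) * (K * ENNReal.ofReal (2 * (1 / 2) ^ j)) := by
          gcongr
          exact card_gridLinks_rpow_le hτ hμ hk j
      _ = K * ENNReal.ofReal ((4 * (3 / 2) ^ j) * (2 * (1 / 2) ^ j)) := by
          rw [ENNReal.ofReal_mul (p := 4 * (3 / 2) ^ j) (by positivity)]; ring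
      _ = K * ENNReal.ofReal (8 * (3 / 4) ^ j) := by
          congr 2
          rw [show (3 / 4 : ℝ) = 3 / 2 * (1 / 2) by norm_num, mul_pow]; ring
      _ = 8 * K * ENNReal.ofReal ((3 / 4) ^ j) := by
          rw [ENNReal.ofReal_mul (by norm_num), ENNReal.ofReal_ofNat]; ring
  have hsum : ∑' j, ((gridLinks τ μ j).card : ℝ≥0∞) ^ (1 / k) * δ j ≤ 32 * K := by
    refine (ENNReal.tsum_le_tsum hterm).trans ?_
    rw [ENNReal.tsum_mul_left, ← ENNReal.ofReal_tsum_of_nonneg (fun n => by positivity)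
      (summable_geometric_of_lt_one (by norm_num) (by norm_num)),
      tsum_geometric_of_lt_one (by norm_num) (by norm_num)]
    rw [show ((1 : ℝ) - 3 / 4)⁻¹ = 4 by norm_num, ENNReal.ofReal_ofNat]
    refine le_of_eq ?_
    rw [show (32 : ℝ≥0∞) = 8 * 4 by norm_num]; ring
  have hδ : ∀ j, ∀ e ∈ gridLinks τ μ j, lpSize P k (fun ω => ‖Z e.1 ω - Z e.2 ω‖ₑ) ≤ δ j := by
    intro j e he
    refine (hinc _ (hE j e he).1 _ (hE j e he).2).trans ?_
    have h7 := (mem_gridLinks.1 he).2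
    change _ ≤ K * ENNReal.ofReal (2 * (1 / 2) ^ j)
    gcongr
    exact max_le (rpow_le_of_abs_le_two_mesh hτ j (abs_nonneg _) h7.1)
      (rpow_le_of_abs_le_two_mesh hμ j (abs_nonneg _) h7.2)
  have happrox : ∀ p ∈ unitSquare,
      Tendsto (fun j => lpSize P k (fun ω => ‖Z (π j p) ω - Z p ω‖ₑ)) atTop (𝓝 0) := by
    intro p hp
    have hbound : ∀ j, lpSize P k (fun ω => ‖Z (π j p) ω - Z p ω‖ₑ) ≤
        K * ENNReal.ofReal ((1 / 2) ^ j) := by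
      intro j
      refine (hinc _ (hπ j p hp) _ hp).trans ?_
      have habs : ∀ m : ℕ, ∀ s ∈ Icc (0 : ℝ) 1, |dyadicFloor m s - s| ≤ (1 / 2) ^ m := by
        intro m s hs
        rw [abs_sub_comm, abs_of_nonneg (sub_nonneg.2 (dyadicFloor_le m hs.1))]
        exact sub_dyadicFloor_le m s
      gcongr
      exact max_le
        ((Real.rpow_le_rpow (abs_nonneg _) (habs _ _ hp.1) hτ.1.le).trans (mesh_rpow_le hτ.1 j))
        ((Real.rpow_le_rpow (abs_nonneg _) (habs _ _ hp.2) hμ.1.le).trans (mesh_rpow_le hμ.1 j))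
    refine tendsto_of_tendsto_of_tendsto_of_le_of_le tendsto_const_nhds ?_ (fun _ => zero_le) hbound
    have h8 : Tendsto (fun j : ℕ => ENNReal.ofReal ((1 / 2 : ℝ) ^ j)) atTop (𝓝 0) := by
      have := ENNReal.tendsto_ofReal
        (tendsto_pow_atTop_nhds_zero_of_lt_one (r := (1 / 2 : ℝ)) (by norm_num) (by norm_num))
      simpa only [ENNReal.ofReal_zero] using this
    simpa only [mul_zero] using ENNReal.Tendsto.const_mul h8 (Or.inr hK.ne)
  have hnear : ∀ j, ∀ p ∈ unitSquare,
      ∀ᶠ q in 𝓝[unitSquare] p, (π j p, π (j + 1) q) ∈ gridLinks τ μ j := by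
    intro j p hp
    have h9 : ∀ᶠ q in 𝓝[unitSquare] p, |p.1 - q.1| < (1 / 2) ^ meshLevel τ j := by
      refine nhdsWithin_le_nhds (ContinuousAt.eventually_lt (by fun_prop) (by fun_prop) ?_)
      simp only [sub_self, abs_zero]; positivity
    have h10 : ∀ᶠ q in 𝓝[unitSquare] p, |p.2 - q.2| < (1 / 2) ^ meshLevel μ j := by
      refine nhdsWithin_le_nhds (ContinuousAt.eventually_lt (by fun_prop) (by fun_prop) ?_)
      simp only [sub_self, abs_zero]; positivity
    filter_upwards [h9, h10, self_mem_nhdsWithin] with q hq1 hq2 hq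
    exact hmem j p hp q hq hq1.le hq2.le
  obtain ⟨Y, R, h1, h2, h3, h4, h5, h6⟩ := exists_continuous_modification_of_chaining (P := P) hk1
    unitSquare Z hZ π hπ (gridLinks τ μ) hE δ
    (fun p hp j => hmem j p hp p hp (by simp) (by simp)) hδ happrox hnear
    (hsum.trans_lt (ENNReal.mul_lt_top (by norm_num) hK))
  refine ⟨Y, R, h1, h2, h3, h4, h5.trans hsum, fun p hp ω => h6 (0, 0) ?_ p hp ?_ ω⟩
  · simp [unitSquare]
  -- At level zero the mesh is one, so every level-one grid point lies within the allowed distance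
  -- of the origin.
  · have hp1 := dyadicFloor_mem_Icc (meshLevel τ (0 + 1)) hp.1
    have hp2 := dyadicFloor_mem_Icc (meshLevel μ (0 + 1)) hp.2
    refine mem_gridLinks.2 ⟨⟨⟨zero_mem_dyadicGrid _, zero_mem_dyadicGrid _⟩,
      dyadicFloor_mem_grid _ hp.1, dyadicFloor_mem_grid _ hp.2⟩, ?_, ?_⟩
    · simp only [π, meshLevel_zero, zero_sub, abs_neg, pow_zero]
      rw [abs_of_nonneg hp1.1]; linarith [hp1.2]
    · simp only [π, meshLevel_zero, zero_sub, abs_neg, pow_zero]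
      rw [abs_of_nonneg hp2.1]; linarith [hp2.2]

/-! ### Transfer to time blocks. -/

/-- The time-space block `[c, d] × [0, 1]`. -/
def block (c d : ℝ) : Set (ℝ × ℝ) := Icc c d ×ˢ Icc (0 : ℝ) 1

/-- An affine change of time reduces this to the unit square; as `d - c ≤ 1`, the change contracts
distances and keeps the Hölder constant. -/
theorem exists_continuous_modification_block {Ω : Type*} [MeasurableSpace Ω] {P : Measure Ω}
    {τ μ k : ℝ} (hτ : τ ∈ Ioo (0 : ℝ) 1) (hμ : μ ∈ Ioo (0 : ℝ) 1) (hk : 4 * (τ⁻¹ + μ⁻¹) ≤ k)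
    {c d : ℝ} (hcd : c < d) (hdc : d ≤ c + 1)
    (Z : ℝ × ℝ → Ω → ℝ) (hZ : ∀ p ∈ block c d, Measurable (Z p)) {K : ℝ≥0∞} (hK : K < ∞)
    (hinc : ∀ p ∈ block c d, ∀ q ∈ block c d, lpSize P k (fun ω => ‖Z p ω - Z q ω‖ₑ) ≤
      K * ENNReal.ofReal (max (|p.1 - q.1| ^ τ) (|p.2 - q.2| ^ μ))) :
    ∃ (Y : ℝ × ℝ → Ω → ℝ) (R : Ω → ℝ≥0∞), (∀ p ∈ block c d, Measurable (Y p)) ∧ Measurable R ∧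
      (∀ p ∈ block c d, Y p =ᵐ[P] Z p) ∧ (∀ ω, ContinuousOn (fun p => Y p ω) (block c d)) ∧
      lpSize P k R ≤ 32 * K ∧ ∀ p ∈ block c d, ∀ ω, ‖Y p ω - Z (c, 0) ω‖ₑ ≤ R ω := by
  have hpos : 0 < d - c := sub_pos.2 hcd
  let φ : ℝ × ℝ → ℝ × ℝ := fun p => (c + (d - c) * p.1, p.2)
  let ψ : ℝ × ℝ → ℝ × ℝ := fun p => ((p.1 - c) / (d - c), p.2)
  have hφ : ∀ p ∈ unitSquare, φ p ∈ block c d := by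
    rintro ⟨s, u⟩ ⟨hs, hu⟩
    refine ⟨⟨?_, ?_⟩, hu⟩ <;> simp only [φ] <;> nlinarith [hs.1, hs.2]
  have hψ : ∀ p ∈ block c d, ψ p ∈ unitSquare := by
    rintro ⟨s, u⟩ ⟨hs, hu⟩
    refine ⟨⟨div_nonneg (sub_nonneg.2 hs.1) hpos.le, ?_⟩, hu⟩
    rw [div_le_one hpos]; linarith [hs.2]
  have hφψ : ∀ p, φ (ψ p) = p := by
    rintro ⟨s, u⟩
    simp only [φ, ψ, mul_div_cancel₀ _ hpos.ne', add_sub_cancel]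
  have hφ0 : φ (0, 0) = (c, 0) := by simp [φ]
  obtain ⟨Y, R, h1, h2, h3, h4, h5, h6⟩ := exists_continuous_modification_unitSquare (P := P)
    hτ hμ hk (fun p => Z (φ p)) (fun p hp => hZ _ (hφ p hp)) hK (fun p hp q hq => by
      refine (hinc _ (hφ p hp) _ (hφ q hq)).trans ?_
      have h1 : |(φ p).1 - (φ q).1| ≤ |p.1 - q.1| := by
        have : (φ p).1 - (φ q).1 = (d - c) * (p.1 - q.1) := by simp only [φ]; ring
        rw [this, abs_mul, abs_of_pos hpos]
        exact mul_le_of_le_one_left (abs_nonneg _) (by linarith)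
      have h2 : (φ p).2 - (φ q).2 = p.2 - q.2 := rfl
      rw [h2]
      have h3 := Real.rpow_le_rpow (abs_nonneg _) h1 hτ.1.le
      gcongr)
  refine ⟨fun p => Y (ψ p), R, fun p hp => h1 _ (hψ p hp), h2, fun p hp => ?_, fun ω => ?_, h5,
    fun p hp ω => ?_⟩
  · simpa only [hφψ] using h3 _ (hψ p hp)
  · exact (h4 ω).comp (by fun_prop) hψ
  · simpa only [hφ0] using h6 _ (hψ p hp) ω

/-! ### From the one-sided increment hypothesis to a Hölder bound on blocks. -/

/-- The `L^k` size of the increment of `X` between two space-time points. -/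
noncomputable def incSize {Ω : Type*} [MeasurableSpace Ω] (P : Measure Ω) (k : ℝ)
    (X : ℝ → ℝ → Ω → ℝ) (p q : ℝ × ℝ) : ℝ≥0∞ :=
  lpSize P k (fun ω => ‖X p.1 p.2 ω - X q.1 q.2 ω‖ₑ)

/-- The growth function `t^{-α} e^{β t}`, the inverse of the weight. -/
noncomputable def growth (α β t : ℝ) : ℝ := t ^ (-α) * Real.exp (β * t)

theorem growth_pos (α β : ℝ) {t : ℝ} (ht : 0 < t) : 0 < growth α β t := by
  unfold growth; positivity

theorem growth_mul_weight (α β : ℝ) {t : ℝ} (ht : 0 < t) :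
    growth α β t * (t ^ α * Real.exp (-β * t)) = 1 := by
  unfold growth
  rw [mul_mul_mul_comm, ← Real.rpow_add ht, ← Real.exp_add]
  simp

section Increments

variable {Ω : Type*} [MeasurableSpace Ω] {P : Measure Ω} {α β τ μ k : ℝ}
  {X : ℝ → ℝ → Ω → ℝ}

theorem incSize_comm (p q : ℝ × ℝ) : incSize P k X p q = incSize P k X q p := by
  unfold incSize
  congr 1
  ext ω
  rw [← edist_eq_enorm_sub, edist_comm, edist_eq_enorm_sub]

theorem incSize_self (hk : 0 < k) (p : ℝ × ℝ) : incSize P k X p p = 0 := by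
  simp [incSize, lpSize, hk]

theorem lpSize_mono (hk : 0 < k) {f g : Ω → ℝ≥0∞} (h : ∀ᵐ ω ∂P, f ω ≤ g ω) :
    lpSize P k f ≤ lpSize P k g := by
  refine ENNReal.rpow_le_rpow (lintegral_mono_ae ?_) (by positivity)
  filter_upwards [h] with ω hω using ENNReal.rpow_le_rpow hω hk.le

theorem incSize_triangle (hk : 1 ≤ k) (hX : ∀ p ∈ domain, Measurable (X p.1 p.2))
    {p q r : ℝ × ℝ} (hp : p ∈ domain) (hq : q ∈ domain) (hr : r ∈ domain) :
    incSize P k X p r ≤ incSize P k X p q + incSize P k X q r := by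
  refine le_trans ?_ (lpSize_add_le hk (((hX p hp).sub (hX q hq)).enorm)
    (((hX q hq).sub (hX r hr)).enorm))
  refine lpSize_mono (by linarith) (ae_of_all _ fun ω => ?_)
  simpa only [edist_eq_enorm_sub] using edist_triangle (X p.1 p.2 ω) (X q.1 q.2 ω) (X r.1 r.2 ω)

theorem incSize_le_of_lt (hk : 0 < k) {t ε x y : ℝ} (ht : 0 < t) (hε : ε ∈ Ioo (0 : ℝ) 1)
    (hx : 0 ≤ x) (hxy : x < y) (hy : y ≤ 1) :
    incSize P k X (t + ε, x) (t, y) ≤ incrementConst P k α β τ μ X *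
      ENNReal.ofReal (growth α β t * max (ε ^ τ) ((y - x) ^ μ)) := by
  have hw : 0 < t ^ α * Real.exp (-β * t) := by positivity
  have hm : 0 < max (ε ^ τ) ((y - x) ^ μ) := lt_max_of_lt_left (Real.rpow_pos_of_pos hε.1 _)
  have h1 : ENNReal.ofReal (t ^ α * Real.exp (-β * t)) *
      eLpNorm (fun ω => X (t + ε) x ω - X t y ω) (ENNReal.ofReal k) P /
      ENNReal.ofReal (max (ε ^ τ) (|x - y| ^ μ)) ≤ incrementConst P k α β τ μ X :=
    le_iSup₂_of_le ε hε (le_iSup₂_of_le t ht (le_iSup₂_of_le x y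
      (le_iSup_of_le ⟨hx, hxy, hy⟩ le_rfl)))
  rw [eLpNorm_eq_lpSize hk, abs_sub_comm, abs_of_pos (sub_pos.2 hxy),
    ENNReal.div_le_iff (ENNReal.ofReal_pos.2 hm).ne' ENNReal.ofReal_ne_top] at h1
  have h2 : ENNReal.ofReal (growth α β t) * ENNReal.ofReal (t ^ α * Real.exp (-β * t)) = 1 := by
    rw [← ENNReal.ofReal_mul (growth_pos α β ht).le, growth_mul_weight α β ht, ENNReal.ofReal_one]
  calc incSize P k X (t + ε, x) (t, y)
      = ENNReal.ofReal (growth α β t) * (ENNReal.ofReal (t ^ α * Real.exp (-β * t)) *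
          incSize P k X (t + ε, x) (t, y)) := by rw [← mul_assoc, h2, one_mul]
    _ ≤ ENNReal.ofReal (growth α β t) * (incrementConst P k α β τ μ X *
          ENNReal.ofReal (max (ε ^ τ) ((y - x) ^ μ))) :=
        mul_le_mul' le_rfl h1
    _ = _ := by rw [ENNReal.ofReal_mul (growth_pos α β ht).le]; ring

/-- Passing to the limit in an `L^k` triangle inequality with error terms vanishing at `0+`. -/
theorem le_mul_ofReal_of_tendsto {C a : ℝ≥0∞} (hC : C < ∞) {F G : ℝ → ℝ} (hF : ContinuousAt F 0)
    (hG : ContinuousAt G 0) (hG0 : G 0 = 0)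
    (h : ∀ᶠ δ in 𝓝[>] (0 : ℝ), a ≤ C * ENNReal.ofReal (F δ) + C * ENNReal.ofReal (G δ)) :
    a ≤ C * ENNReal.ofReal (F 0) := by
  have hlim : Tendsto (fun δ => C * ENNReal.ofReal (F δ) + C * ENNReal.ofReal (G δ)) (𝓝[>] 0)
      (𝓝 (C * ENNReal.ofReal (F 0) + C * ENNReal.ofReal (G 0))) := by
    refine Tendsto.mono_left ?_ nhdsWithin_le_nhds
    exact (ENNReal.Tendsto.const_mul (ENNReal.tendsto_ofReal hF) (Or.inr hC.ne)).add
      (ENNReal.Tendsto.const_mul (ENNReal.tendsto_ofReal hG) (Or.inr hC.ne))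
  simpa [hG0] using ge_of_tendsto hlim h

theorem continuousAt_growth (α β : ℝ) {t : ℝ} (ht : 0 < t) : ContinuousAt (growth α β) t := by
  unfold growth
  exact (Real.continuousAt_rpow_const _ _ (Or.inl ht.ne')).mul (by fun_prop)

theorem continuousAt_max_rpow (hτ : 0 < τ) (hμ : 0 < μ) (a b : ℝ) :
    ContinuousAt (fun δ : ℝ => max ((a + δ) ^ τ) ((b + δ) ^ μ)) 0 := by
  have h1 : Continuous fun δ : ℝ => (a + δ) ^ τ :=
    (Real.continuous_rpow_const hτ.le).comp (continuous_const_add a)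
  have h2 : Continuous fun δ : ℝ => (b + δ) ^ μ :=
    (Real.continuous_rpow_const hμ.le).comp (continuous_const_add b)
  exact (h1.max h2).continuousAt

/-- Equality in time or space is reached by a detour through a point that is strictly earlier and to
the right of both, `(t - δ, y + δ)`, or strictly later and to the left of both, `(t + ε + δ, x -
δ)`. Both legs then have the admissible order, and the short one vanishes as `δ → 0`. `hint` says
that there is room on at least one side. -/
theorem incSize_le_of_le (hk : 1 ≤ k) (hτ : 0 < τ) (hμ : 0 < μ)
    (hX : ∀ p ∈ domain, Measurable (X p.1 p.2)) (hC : incrementConst P k α β τ μ X < ∞)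
    {t ε x y : ℝ} (ht : 0 < t) (hε : ε ∈ Ico (0 : ℝ) 1) (hx : 0 ≤ x) (hxy : x ≤ y) (hy : y ≤ 1)
    (hint : y < 1 ∨ 0 < x) :
    incSize P k X (t + ε, x) (t, y) ≤ incrementConst P k α β τ μ X *
      ENNReal.ofReal (growth α β t * max (ε ^ τ) ((y - x) ^ μ)) := by
  have hk0 : 0 < k := by linarith
  have hmax := continuousAt_max_rpow hτ hμ
  have hmem : ∀ {s z : ℝ}, 0 < s → 0 ≤ z → z ≤ 1 → (s, z) ∈ domain := fun h1 h2 h3 => ⟨h1, h2, h3⟩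
  have hsmall : ∀ {b : ℝ}, 0 < b → ∀ᶠ δ in 𝓝[>] (0 : ℝ), δ < b := fun hb =>
    nhdsWithin_le_nhds (gt_mem_nhds hb)
  rcases hint with hy1 | hx0
  · have hgr : ContinuousAt (fun δ : ℝ => growth α β (t - δ)) 0 :=
      ContinuousAt.comp (g := growth α β) (f := fun δ : ℝ => t - δ)
        (by simpa using continuousAt_growth α β ht) (by fun_prop)
    have := le_mul_ofReal_of_tendsto (a := incSize P k X (t + ε, x) (t, y)) hC
      (hgr.mul (hmax ε (y - x))) (hgr.mul (hmax 0 0))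
      (by simp [Real.zero_rpow hτ.ne', Real.zero_rpow hμ.ne']) ?_
    · simpa using this
    · filter_upwards [self_mem_nhdsWithin, hsmall ht, hsmall (sub_pos.2 hε.2),
        hsmall (sub_pos.2 hy1)] with δ hδ h1 h2 h3
      have hδ' : 0 < δ := hδ
      refine (incSize_triangle hk hX (q := (t - δ, y + δ)) (hmem (by linarith [hε.1]) hx (by linarith))
        (hmem (by linarith) (by linarith) (by linarith)) (hmem ht (by linarith) hy)).trans ?_
      rw [incSize_comm (t - δ, y + δ)]
      have e1 := incSize_le_of_lt (P := P) (X := X) (α := α) (β := β) (τ := τ) (μ := μ) hk0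
        (t := t - δ) (ε := ε + δ) (x := x) (y := y + δ)
        (by linarith) ⟨by linarith [hε.1], by linarith⟩ hx (by linarith) (by linarith)
      have e2 := incSize_le_of_lt (P := P) (X := X) (α := α) (β := β) (τ := τ) (μ := μ) hk0
        (t := t - δ) (ε := δ) (x := y) (y := y + δ)
        (by linarith) ⟨by linarith [hε.1], by linarith [hε.1]⟩ (by linarith) (by linarith)
        (by linarith)
      rw [show t - δ + (ε + δ) = t + ε by ring, show y + δ - x = y - x + δ by ring] at e1
      rw [sub_add_cancel, add_sub_cancel_left] at e2
      simp only [zero_add]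
      exact add_le_add e1 e2
  · have := le_mul_ofReal_of_tendsto (a := incSize P k X (t + ε, x) (t, y)) hC
      ((continuousAt_const (y := growth α β t)).mul (hmax ε (y - x)))
      ((continuousAt_const (y := growth α β (t + ε))).mul (hmax 0 0))
      (by simp [Real.zero_rpow hτ.ne', Real.zero_rpow hμ.ne']) ?_
    · simpa using this
    · filter_upwards [self_mem_nhdsWithin, hsmall hx0, hsmall (sub_pos.2 hε.2)] with δ hδ h1 h2
      have hδ' : 0 < δ := hδ
      have hte : 0 < t + ε := by linarith [hε.1]
      refine (incSize_triangle hk hX (q := (t + ε + δ, x - δ)) (hmem hte hx (by linarith))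
        (hmem (by linarith) (by linarith) (by linarith)) (hmem ht (by linarith) hy)).trans ?_
      rw [incSize_comm (t + ε, x), add_comm]
      have e1 := incSize_le_of_lt (P := P) (X := X) (α := α) (β := β) (τ := τ) (μ := μ) hk0
        (t := t) (ε := ε + δ) (x := x - δ) (y := y)
        ht ⟨by linarith [hε.1], by linarith⟩ (by linarith) (by linarith) hy
      have e2 := incSize_le_of_lt (P := P) (X := X) (α := α) (β := β) (τ := τ) (μ := μ) hk0
        (t := t + ε) (ε := δ) (x := x - δ) (y := x)
        hte ⟨hδ', by linarith [hε.1]⟩ (by linarith) (by linarith) (by linarith)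
      rw [← add_assoc, show y - (x - δ) = y - x + δ by ring] at e1
      rw [show x - (x - δ) = δ by ring] at e2
      simp only [zero_add]
      exact add_le_add e1 e2

/-- Passing through the midpoint settles two boundary cases at once: a time difference equal to one
is halved below one, and each half of `[0, 1]` leaves room on one side for `incSize_le_of_le`. -/
theorem incSize_le_of_ordered (hk : 1 ≤ k) (hτ : 0 < τ) (hμ : 0 < μ)
    (hX : ∀ p ∈ domain, Measurable (X p.1 p.2)) (hC : incrementConst P k α β τ μ X < ∞)
    {c d W : ℝ} (hc : 0 < c) (hdc : d ≤ c + 1) (hW : ∀ t ∈ Icc c d, growth α β t ≤ W)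
    {s t x y : ℝ} (hs : s ∈ Icc c d) (ht : t ∈ Icc c d) (hst : t ≤ s)
    (hx : 0 ≤ x) (hxy : x ≤ y) (hy : y ≤ 1) :
    incSize P k X (s, x) (t, y) ≤ 2 * (incrementConst P k α β τ μ X *
      ENNReal.ofReal (W * max ((s - t) ^ τ) ((y - x) ^ μ))) := by
  have hlt : (s - t) / 2 < 1 := by linarith [hs.2, ht.1]
  have hge : 0 ≤ (s - t) / 2 := by linarith
  have ht0 : 0 < t := hc.trans_le ht.1
  have hW0 : 0 ≤ W := (growth_pos α β ht0).le.trans (hW t ht)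
  have hpτ : ((s - t) / 2) ^ τ ≤ (s - t) ^ τ := Real.rpow_le_rpow hge (by linarith) hτ.le
  have hpμ : ((y - x) / 2) ^ μ ≤ (y - x) ^ μ :=
    Real.rpow_le_rpow (by linarith) (by linarith) hμ.le
  have hmid : t + (s - t) / 2 ∈ Icc c d := ⟨by linarith [ht.1], by linarith [hs.2]⟩
  have e1 := incSize_le_of_le (P := P) (α := α) (β := β) hk hτ hμ hX hC
    (t := t + (s - t) / 2) (ε := (s - t) / 2) (x := x) (y := (x + y) / 2) (by linarith)
    ⟨hge, hlt⟩ hx (by linarith) (by linarith)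
    (by rcases hx.eq_or_lt with h | h
        · left; linarith
        · right; exact h)
  have e2 := incSize_le_of_le (P := P) (α := α) (β := β) hk hτ hμ hX hC
    (t := t) (ε := (s - t) / 2) (x := (x + y) / 2) (y := y) ht0
    ⟨hge, hlt⟩ (by linarith) (by linarith) hy
    (by rcases hy.eq_or_lt with h | h
        · right; linarith
        · left; exact h)
  rw [show t + (s - t) / 2 + (s - t) / 2 = s by ring,
    show (x + y) / 2 - x = (y - x) / 2 by ring] at e1
  rw [show y - (x + y) / 2 = (y - x) / 2 by ring] at e2
  refine (incSize_triangle hk hX (p := (s, x)) (q := (t + (s - t) / 2, (x + y) / 2)) (r := (t, y))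
    ⟨hc.trans_le hs.1, hx, by linarith⟩ ⟨hc.trans_le hmid.1, by linarith, by linarith⟩
    ⟨ht0, by linarith, hy⟩).trans ?_
  rw [two_mul]
  refine add_le_add (e1.trans ?_) (e2.trans ?_)
  · gcongr
    exact hW _ hmid
  · gcongr
    exact hW _ ht

/-- The path through `(s, y)` splits the increment into a pure space step and a pure time step. Each
can be ordered by symmetry and costs a factor two. -/
theorem incSize_block_le (hk : 1 ≤ k) (hτ : 0 < τ) (hμ : 0 < μ)
    (hX : ∀ p ∈ domain, Measurable (X p.1 p.2)) (hC : incrementConst P k α β τ μ X < ∞)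
    {c d W : ℝ} (hc : 0 < c) (hdc : d ≤ c + 1) (hW : ∀ t ∈ Icc c d, growth α β t ≤ W)
    {p q : ℝ × ℝ} (hp : p ∈ block c d) (hq : q ∈ block c d) :
    incSize P k X p q ≤ 4 * incrementConst P k α β τ μ X * ENNReal.ofReal W *
      ENNReal.ofReal (max (|p.1 - q.1| ^ τ) (|p.2 - q.2| ^ μ)) := by
  obtain ⟨s, x⟩ := p
  obtain ⟨t, y⟩ := q
  obtain ⟨hs, hx⟩ := hp
  obtain ⟨ht, hy⟩ := hq
  simp only at hs hx ht hy ⊢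
  have hs0 : 0 < s := hc.trans_le hs.1
  have hW0 : 0 ≤ W := (growth_pos α β hs0).le.trans (hW s hs)
  set C := incrementConst P k α β τ μ X
  set m := max (|s - t| ^ τ) (|x - y| ^ μ) with hm
  have hspace : incSize P k X (s, x) (s, y) ≤ 2 * (C * ENNReal.ofReal (W * m)) := by
    have key : ∀ {x y : ℝ}, x ∈ Icc (0 : ℝ) 1 → y ∈ Icc (0 : ℝ) 1 → x ≤ y →
        incSize P k X (s, x) (s, y) ≤
          2 * (C * ENNReal.ofReal (W * max (|s - t| ^ τ) (|x - y| ^ μ))) := by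
      intro x y hx hy hxy
      refine (incSize_le_of_ordered hk hτ hμ hX hC hc hdc hW hs hs le_rfl hx.1 hxy hy.2).trans ?_
      rw [sub_self, Real.zero_rpow hτ.ne', abs_sub_comm x, abs_of_nonneg (sub_nonneg.2 hxy)]
      gcongr
      positivity
    rcases le_total x y with h | h
    · exact key hx hy h
    · rw [incSize_comm, hm, abs_sub_comm x]
      exact key hy hx h
  have htime : incSize P k X (s, y) (t, y) ≤ 2 * (C * ENNReal.ofReal (W * m)) := by
    have key : ∀ {s t : ℝ}, s ∈ Icc c d → t ∈ Icc c d → t ≤ s →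
        incSize P k X (s, y) (t, y) ≤
          2 * (C * ENNReal.ofReal (W * max (|s - t| ^ τ) (|x - y| ^ μ))) := by
      intro s t hs ht hst
      refine (incSize_le_of_ordered hk hτ hμ hX hC hc hdc hW hs ht hst hy.1 le_rfl hy.2).trans ?_
      rw [sub_self, Real.zero_rpow hμ.ne', abs_of_nonneg (sub_nonneg.2 hst)]
      gcongr
      positivity
    rcases le_total t s with h | h
    · exact key hs ht h
    · rw [incSize_comm, hm, abs_sub_comm s]
      exact key ht hs h
  refine (incSize_triangle hk hX (p := (s, x)) (q := (s, y)) (r := (t, y)) ⟨hs0, hx⟩ ⟨hs0, hy⟩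
    ⟨hc.trans_le ht.1, hy⟩).trans ((add_le_add hspace htime).trans (le_of_eq ?_))
  rw [ENNReal.ofReal_mul hW0, show (4 : ℝ≥0∞) = 2 + 2 by norm_num]
  ring

/-- On a block of the domain, `X` has a continuous modification whose oscillation is controlled by
the increment constant. -/
theorem exists_block_modification (hτ : τ ∈ Ioo (0 : ℝ) 1) (hμ : μ ∈ Ioo (0 : ℝ) 1)
    (hk : 4 * (τ⁻¹ + μ⁻¹) ≤ k)
    (hX : ∀ p ∈ domain, Measurable (X p.1 p.2)) (hC : incrementConst P k α β τ μ X < ∞)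
    {c d W : ℝ} (hc : 0 < c) (hcd : c < d) (hdc : d ≤ c + 1)
    (hW : ∀ t ∈ Icc c d, growth α β t ≤ W) :
    ∃ (Y : ℝ × ℝ → Ω → ℝ) (R : Ω → ℝ≥0∞), (∀ p ∈ block c d, Measurable (Y p)) ∧ Measurable R ∧
      (∀ p ∈ block c d, Y p =ᵐ[P] X p.1 p.2) ∧ (∀ ω, ContinuousOn (fun p => Y p ω) (block c d)) ∧
      lpSize P k R ≤ 128 * incrementConst P k α β τ μ X * ENNReal.ofReal W ∧
      ∀ p ∈ block c d, ∀ ω, ‖Y p ω - X c 0 ω‖ₑ ≤ R ω := by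
  have hτ1 : 1 < τ⁻¹ := (one_lt_inv₀ hτ.1).2 hτ.2
  have hμ1 : 1 < μ⁻¹ := (one_lt_inv₀ hμ.1).2 hμ.2
  obtain ⟨Y, R, h1, h2, h3, h4, h5, h6⟩ := exists_continuous_modification_block (P := P) hτ hμ hk
    hcd hdc (fun p => X p.1 p.2) (fun p hp => hX p ⟨hc.trans_le hp.1.1, hp.2⟩)
    (K := 4 * incrementConst P k α β τ μ X * ENNReal.ofReal W)
    (ENNReal.mul_lt_top (ENNReal.mul_lt_top (by norm_num) hC) ENNReal.ofReal_lt_top)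
    (fun p hp q hq => incSize_block_le (by linarith) hτ.1 hμ.1 hX hC hc hdc hW hp hq)
  refine ⟨Y, R, h1, h2, h3, h4, h5.trans (le_of_eq ?_), h6⟩
  rw [show (128 : ℝ≥0∞) = 32 * 4 by norm_num]
  ring

end Increments

/-! ### Gluing the block modifications. -/

/-- Two modifications that are almost surely continuous on a set agree there almost surely. -/
theorem ae_eqOn_of_modification {Ω : Type*} [MeasurableSpace Ω] {P : Measure Ω} {S : Set (ℝ × ℝ)}
    {Y Z : ℝ × ℝ → Ω → ℝ} (h : ∀ p ∈ S, Y p =ᵐ[P] Z p)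
    (hY : ∀ᵐ ω ∂P, ContinuousOn (fun p => Y p ω) S)
    (hZ : ∀ᵐ ω ∂P, ContinuousOn (fun p => Z p ω) S) :
    ∀ᵐ ω ∂P, ∀ p ∈ S, Y p ω = Z p ω := by
  obtain ⟨D, hDS, hDc, hD⟩ :=
    (TopologicalSpace.IsSeparable.of_separableSpace S).exists_countable_dense_subset
  have hall : ∀ᵐ ω ∂P, ∀ p ∈ D, Y p ω = Z p ω :=
    (ae_ball_iff hDc).2 fun p hp => h p (hDS hp)
  filter_upwards [hall, hY, hZ] with ω h1 h2 h3
  exact Set.EqOn.of_subset_closure (f := fun p => Y p ω) (g := fun p => Z p ω) h1 h2 h3 hDS hD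

theorem growth_le {α β : ℝ} (hα : 0 ≤ α) (hβ : 0 ≤ β) {c d t : ℝ} (hc : 0 < c)
    (ht : t ∈ Icc c d) : growth α β t ≤ c ^ (-α) * Real.exp (β * d) := by
  unfold growth
  gcongr ?_ * Real.exp (β * ?_)
  · exact Real.rpow_le_rpow_of_nonpos hc ht.1 (by linarith)
  · exact ht.2

/-- Rational time intervals of length at most one inside `(0, ∞)`. -/
def RatInterval : Type := {q : ℚ × ℚ // 0 < q.1 ∧ q.1 < q.2 ∧ q.2 ≤ q.1 + 1}

instance : Countable RatInterval := Subtype.countable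

theorem exists_ratInterval {t : ℝ} (ht : 0 < t) :
    ∃ q : RatInterval, t ∈ Ioo (q.1.1 : ℝ) (q.1.2 : ℝ) := by
  obtain ⟨a, ha, hat⟩ := exists_rat_btwn (max_lt ht (by linarith : t - 1 / 2 < t))
  obtain ⟨b, htb, hb⟩ := exists_rat_btwn (by linarith : t < t + 1 / 2)
  obtain ⟨ha0, ha1⟩ := max_lt_iff.1 ha
  refine ⟨⟨(a, b), ?_, ?_, ?_⟩, hat, htb⟩
  · exact_mod_cast ha0
  · exact_mod_cast hat.trans htb
  · have : (b : ℝ) ≤ a + 1 := by linarith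
    exact_mod_cast this

theorem exists_continuous_modification {Ω : Type*} [MeasurableSpace Ω] {P : Measure Ω}
    {α β τ μ k : ℝ} (hα : 0 < α) (hβ : 1 ≤ β) (hτ : τ ∈ Ioo (0 : ℝ) 1) (hμ : μ ∈ Ioo (0 : ℝ) 1)
    (hk : 4 * (τ⁻¹ + μ⁻¹) ≤ k) {X : ℝ → ℝ → Ω → ℝ}
    (hX : ∀ p ∈ domain, Measurable (X p.1 p.2)) (hC : incrementConst P k α β τ μ X < ∞) :
    ∃ Y : ℝ → ℝ → Ω → ℝ, (∀ p ∈ domain, Measurable (Y p.1 p.2)) ∧ IsModification P X Y ∧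
      ∀ ω, ContinuousOn (fun p : ℝ × ℝ => Y p.1 p.2 ω) domain := by
  have hloc : ∀ q : RatInterval, ∃ Y : ℝ × ℝ → Ω → ℝ,
      (∀ p ∈ block q.1.1 q.1.2, Measurable (Y p)) ∧
      (∀ p ∈ block q.1.1 q.1.2, Y p =ᵐ[P] X p.1 p.2) ∧
      ∀ ω, ContinuousOn (fun p => Y p ω) (block q.1.1 q.1.2) := by
    rintro ⟨⟨a, b⟩, h1, h2, h3⟩
    simp only at h1 h2 h3 ⊢
    have ha : (0 : ℝ) < a := by exact_mod_cast h1
    obtain ⟨Y, R, e1, -, e2, e3, -⟩ := exists_block_modification (P := P) hτ hμ hk hX hC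
      (c := a) (d := b) ha (by exact_mod_cast h2) (by exact_mod_cast h3)
      (fun t ht => growth_le hα.le (by linarith) ha ht)
    exact ⟨Y, e1, e2, e3⟩
  choose Yq hYm hYmod hYc using hloc
  have hgood : ∀ᵐ ω ∂P, ∀ q r : RatInterval, ∀ p ∈ block q.1.1 q.1.2 ∩ block r.1.1 r.1.2,
      Yq q p ω = Yq r p ω := by
    refine ae_all_iff.2 fun q => ae_all_iff.2 fun r => ae_eqOn_of_modification
      (fun p hp => (hYmod q p hp.1).trans (hYmod r p hp.2).symm)
      (ae_of_all _ fun ω => (hYc q ω).mono inter_subset_left)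
      (ae_of_all _ fun ω => (hYc r ω).mono inter_subset_right)
  -- The set where two versions disagree need not be measurable; a measurable null superset allows
  -- setting the field to zero there while keeping it measurable.
  obtain ⟨N, hNsub, hNm, hN0⟩ := exists_measurable_superset_of_null (ae_iff.1 hgood)
  have hNgood : ∀ ω ∉ N, ∀ q r : RatInterval, ∀ p ∈ block q.1.1 q.1.2 ∩ block r.1.1 r.1.2,
      Yq q p ω = Yq r p ω := fun ω hω => by
    by_contra hcon
    exact hω (hNsub hcon)
  have hNae : ∀ᵐ ω ∂P, ω ∉ N := measure_eq_zero_iff_ae_notMem.1 hN0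
  have : Nonempty RatInterval := (exists_ratInterval one_pos).nonempty
  -- The choice of interval may depend on `t` in any manner: off `N` all versions agree on overlaps,
  -- so near `p` the field coincides with the single version chosen at `p`.
  choose! i hi using fun (t : ℝ) (ht : t ∈ Ioi (0 : ℝ)) => exists_ratInterval ht
  have hib : ∀ p ∈ domain, p ∈ block (i p.1).1.1 (i p.1).1.2 := fun p hp =>
    ⟨Ioo_subset_Icc_self (hi p.1 hp.1), hp.2⟩
  refine ⟨fun t x => Nᶜ.indicator (Yq (i t) (t, x)), fun p hp => ?_, fun p hp => ?_, fun ω => ?_⟩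
  · exact (hYm _ _ (hib p hp)).indicator hNm.compl
  · filter_upwards [hYmod _ _ (hib p hp), hNae] with ω h1 h2
    rw [indicator_of_mem h2]
    exact h1
  · by_cases hω : ω ∈ N
    · simp only [indicator_of_notMem (fun h : ω ∈ Nᶜ => h hω)]
      exact continuousOn_const
    · have hω' : ω ∈ Nᶜ := hω
      simp only [indicator_of_mem hω']
      intro p hp
      have hnb : {r : ℝ × ℝ | r.1 ∈ Ioo ((i p.1).1.1 : ℝ) ((i p.1).1.2 : ℝ)} ∈ 𝓝[domain] p :=
        nhdsWithin_le_nhds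
          ((isOpen_Ioo.preimage continuous_fst).mem_nhds (hi p.1 hp.1))
      have hbl : block (i p.1).1.1 (i p.1).1.2 ∈ 𝓝[domain] p := by
        filter_upwards [hnb, self_mem_nhdsWithin] with r h1 h2
        exact ⟨Ioo_subset_Icc_self h1, h2.2⟩
      have hcont := ((hYc (i p.1) ω) p (hib p hp)).mono_of_mem_nhdsWithin hbl
      refine hcont.congr_of_eventuallyEq ?_ rfl
      filter_upwards [hbl, self_mem_nhdsWithin] with r h1 h2
      exact hNgood ω hω _ _ r ⟨hib r h2, h1⟩

/-! ### Weighted majorants summed over blocks. -/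

section Majorant

variable {Ω : Type*} [MeasurableSpace Ω] {P : Measure Ω} {α β τ μ k : ℝ}
  {X Y : ℝ → ℝ → Ω → ℝ} {α' β' : ℝ} {Z₀ : Ω → ℝ} {B : ℝ≥0∞}

/-- An `L^k` majorant of the weighted field `Y - Z₀` on a sequence of blocks. -/
theorem exists_majorant_of_blocks (hτ : τ ∈ Ioo (0 : ℝ) 1) (hμ : μ ∈ Ioo (0 : ℝ) 1)
    (hk : 4 * (τ⁻¹ + μ⁻¹) ≤ k)
    (hX : ∀ p ∈ domain, Measurable (X p.1 p.2)) (hC : incrementConst P k α β τ μ X < ∞)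
    (hY : IsModification P X Y)
    (hYc : ∀ᵐ ω ∂P, ContinuousOn (fun p : ℝ × ℝ => Y p.1 p.2 ω) domain) (hZ₀ : Measurable Z₀)
    {c d W w : ℕ → ℝ} (hc : ∀ n, 0 < c n) (hcd : ∀ n, c n < d n) (hdc : ∀ n, d n ≤ c n + 1)
    (hW : ∀ n, ∀ t ∈ Icc (c n) (d n), growth α β t ≤ W n)
    (hw : ∀ n, ∀ t ∈ Icc (c n) (d n), t ^ α' * Real.exp (-β' * t) ≤ w n)
    (hbase : ∀ n, lpSize P k (fun ω => ‖X (c n) 0 ω - Z₀ ω‖ₑ) ≤ B * ENNReal.ofReal (W n)) :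
    ∃ G : Ω → ℝ≥0∞, Measurable G ∧
      (∀ᵐ ω ∂P, ∀ n, ∀ p ∈ block (c n) (d n),
        ENNReal.ofReal (p.1 ^ α' * Real.exp (-β' * p.1) * |Y p.1 p.2 ω - Z₀ ω|) ≤ G ω) ∧
      lpSize P k G ≤ (B + 128 * incrementConst P k α β τ μ X) *
        ∑' n, ENNReal.ofReal (w n * W n) := by
  have hτ1 : 1 < τ⁻¹ := (one_lt_inv₀ hτ.1).2 hτ.2
  have hμ1 : 1 < μ⁻¹ := (one_lt_inv₀ hμ.1).2 hμ.2
  have hk1 : 1 ≤ k := by linarith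
  choose V R _ hRm hVmod hVc hRs hVR using fun n =>
    exists_block_modification (P := P) hτ hμ hk hX hC (hc n) (hcd n) (hdc n) (hW n)
  have hsub : ∀ n, block (c n) (d n) ⊆ domain := fun n p hp => ⟨(hc n).trans_le hp.1.1, hp.2⟩
  have hVY : ∀ᵐ ω ∂P, ∀ n, ∀ p ∈ block (c n) (d n), Y p.1 p.2 ω = V n p ω :=
    ae_all_iff.2 fun n => ae_eqOn_of_modification (Y := fun p => Y p.1 p.2)
      (fun p hp => (hY p (hsub n hp)).trans (hVmod n p hp).symm)
      (hYc.mono fun ω h => h.mono (hsub n)) (ae_of_all _ (hVc n))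
  have hbm : ∀ n, Measurable fun ω => ‖X (c n) 0 ω - Z₀ ω‖ₑ := fun n =>
    ((hX (c n, 0) ⟨hc n, by simp⟩).sub hZ₀).enorm
  have hw0 : ∀ n, 0 ≤ w n := fun n => by
    have := hc n
    exact le_trans (by positivity) (hw n (c n) ⟨le_rfl, (hcd n).le⟩)
  -- The triangle inequality through the block's corner `X (c n) 0`. The supremum over blocks is
  -- then replaced by a sum, to which Minkowski applies.
  let g : ℕ → Ω → ℝ≥0∞ := fun n ω => ENNReal.ofReal (w n) * (‖X (c n) 0 ω - Z₀ ω‖ₑ + R n ω)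
  have hgm : ∀ n, Measurable (g n) := fun n => ((hbm n).add (hRm n)).const_mul _
  refine ⟨fun ω => ∑' n, g n ω, Measurable.tsum hgm, ?_, ?_⟩
  · filter_upwards [hVY] with ω hω n p hp
    refine le_trans ?_ (ENNReal.le_tsum n)
    rw [ENNReal.ofReal_mul (by
      have := (hsub n hp).1
      exact mul_nonneg (Real.rpow_nonneg (le_of_lt this) _) (Real.exp_pos _).le)]
    refine mul_le_mul' (ENNReal.ofReal_le_ofReal (hw n p.1 hp.1)) ?_
    rw [← Real.norm_eq_abs, ofReal_norm, hω n p hp, add_comm]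
    refine le_trans ?_ (add_le_add (hVR n p hp ω) le_rfl)
    simpa only [edist_eq_enorm_sub] using edist_triangle (V n p ω) (X (c n) 0 ω) (Z₀ ω)
  · refine (lpSize_tsum_le hk1 hgm).trans ?_
    rw [← ENNReal.tsum_mul_left]
    refine ENNReal.tsum_le_tsum fun n => ?_
    have hmul : lpSize P k (g n) = ENNReal.ofReal (w n) *
        lpSize P k (fun ω => ‖X (c n) 0 ω - Z₀ ω‖ₑ + R n ω) :=
      lpSize_const_mul (by linarith) _ ((hbm n).add (hRm n))
    rw [hmul, ENNReal.ofReal_mul (hw0 n)]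
    calc ENNReal.ofReal (w n) * lpSize P k (fun ω => ‖X (c n) 0 ω - Z₀ ω‖ₑ + R n ω)
        ≤ ENNReal.ofReal (w n) * (B * ENNReal.ofReal (W n) +
          128 * incrementConst P k α β τ μ X * ENNReal.ofReal (W n)) := by
          gcongr
          exact (lpSize_add_le hk1 (hbm n) (hRm n)).trans (add_le_add (hbase n) (hRs n))
      _ = _ := by ring

theorem weight_le (hα' : 0 ≤ α') (hβ' : 0 ≤ β') {c d t : ℝ} (hc : 0 < c) (ht : t ∈ Icc c d) :
    t ^ α' * Real.exp (-β' * t) ≤ d ^ α' * Real.exp (-β' * c) := by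
  have h0 : 0 < t := hc.trans_le ht.1
  have h1 : t ^ α' ≤ d ^ α' := Real.rpow_le_rpow h0.le ht.2 hα'
  have h2 : Real.exp (-β' * t) ≤ Real.exp (-β' * c) :=
    Real.exp_le_exp.2 (by nlinarith [ht.1])
  have h3 : 0 < d := h0.trans_le ht.2
  gcongr

theorem rpow_neg_le_of_inv_le (hα : 0 ≤ α) (hβ : 0 < β) {c : ℝ} (hc : β⁻¹ ≤ c) :
    c ^ (-α) ≤ β ^ α := by
  calc c ^ (-α) ≤ (β⁻¹) ^ (-α) :=
        Real.rpow_le_rpow_of_nonpos (by positivity) hc (by linarith)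
    _ = β ^ α := by rw [Real.inv_rpow hβ.le, Real.rpow_neg hβ.le, inv_inv]

theorem le_rpow_neg_of_le_inv (hα : 0 ≤ α) (hβ : 0 < β) {c : ℝ} (hc0 : 0 < c) (hc : c ≤ β⁻¹) :
    β ^ α ≤ c ^ (-α) := by
  calc β ^ α = (β⁻¹) ^ (-α) := by rw [Real.inv_rpow hβ.le, Real.rpow_neg hβ.le, inv_inv]
    _ ≤ c ^ (-α) := Real.rpow_le_rpow_of_nonpos hc0 hc (by linarith)

/-- Exponential decay beats any power. Without this the real `tsum` in `constL` would take its
default value zero and bound nothing. -/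
theorem summable_constL_term (hβ : 0 < β) (hβ' : β < β') :
    Summable fun n : ℕ => ((n : ℝ) + 1) ^ (α' + α) * Real.exp (-(n : ℝ) * (β' - β) / β) := by
  set r : ℝ := (β' - β) / β
  have hr : 0 < r := div_pos (by linarith) hβ
  set m : ℕ := ⌈α' + α⌉₊
  have h1 := (summable_nat_add_iff 1).2 (Real.summable_pow_mul_exp_neg_nat_mul m hr)
  refine Summable.of_nonneg_of_le (fun n => by positivity) (fun n => ?_)
    (h1.mul_left (Real.exp r))
  have h2 : ((n : ℝ) + 1) ^ (α' + α) ≤ ((n : ℝ) + 1) ^ m := by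
    rw [← Real.rpow_natCast]
    exact Real.rpow_le_rpow_of_exponent_le (by linarith [n.cast_nonneg (α := ℝ)]) (Nat.le_ceil _)
  have h3 : Real.exp (-(n : ℝ) * (β' - β) / β) =
      Real.exp r * Real.exp (-r * ((n + 1 : ℕ) : ℝ)) := by
    rw [← Real.exp_add]
    congr 1
    push_cast
    rw [mul_div_assoc]
    ring
  rw [h3, mul_left_comm]
  push_cast
  gcongr

/-- The sum over the dyadic blocks in `(0, 1 / β]`. -/
theorem tsum_dyadic_blocks_le (hβ : 1 ≤ β) (hαα' : α < α') :
    ∑' n : ℕ, ENNReal.ofReal (((1 / 2) ^ n / β) ^ α' *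
      (((1 / 2) ^ (n + 1) / β) ^ (-α) * Real.exp 1)) ≤
      ENNReal.ofReal (Real.exp 1 * ((2 : ℝ) ^ α' / ((2 : ℝ) ^ (α' - α) - 1))) := by
  have hβ0 : 0 < β := by linarith
  set s := α' - α with hs
  have hs0 : 0 < s := by simp only [hs]; linarith
  have hr1 : ((1 : ℝ) / 2) ^ s < 1 := Real.rpow_lt_one (by norm_num) (by norm_num) hs0
  have h2s : 1 < (2 : ℝ) ^ s := Real.one_lt_rpow (by norm_num) hs0
  have hterm : ∀ n : ℕ, ((1 / 2) ^ n / β) ^ α' * (((1 / 2) ^ (n + 1) / β) ^ (-α) * Real.exp 1) ≤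
      Real.exp 1 * 2 ^ α * (((1 : ℝ) / 2) ^ s) ^ n := by
    intro n
    set y : ℝ := (1 / 2) ^ n / β with hy
    have hy0 : 0 < y := by positivity
    have h1 : ((1 : ℝ) / 2) ^ (n + 1) / β = y * (1 / 2) := by rw [hy, pow_succ]; ring
    have h2 : ((1 : ℝ) / 2) ^ (-α) = 2 ^ α := by
      rw [one_div, Real.inv_rpow (by norm_num), Real.rpow_neg (by norm_num), inv_inv]
    rw [h1, Real.mul_rpow hy0.le (by norm_num), h2]
    calc y ^ α' * (y ^ (-α) * 2 ^ α * Real.exp 1) = Real.exp 1 * 2 ^ α * (y ^ α' * y ^ (-α)) := by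
          ring
      _ = Real.exp 1 * 2 ^ α * y ^ s := by rw [← Real.rpow_add hy0, ← sub_eq_add_neg]
      _ ≤ Real.exp 1 * 2 ^ α * ((1 / 2) ^ n) ^ s := by
          gcongr
          -- Here `1 ≤ β` is used to discard the power of `β`.
          exact div_le_self (by positivity) hβ
      _ = _ := by rw [Real.rpow_pow_comm (by norm_num)]
  calc _ ≤ ∑' n : ℕ, ENNReal.ofReal (Real.exp 1 * 2 ^ α * (((1 : ℝ) / 2) ^ s) ^ n) :=
        ENNReal.tsum_le_tsum fun n => ENNReal.ofReal_le_ofReal (hterm n)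
    _ = ENNReal.ofReal (∑' n : ℕ, Real.exp 1 * 2 ^ α * (((1 : ℝ) / 2) ^ s) ^ n) :=
        (ENNReal.ofReal_tsum_of_nonneg (fun n => by positivity)
          ((summable_geometric_of_lt_one (by positivity) hr1).mul_left _)).symm
    _ = _ := by
        congr 1
        rw [tsum_mul_left, tsum_geometric_of_lt_one (by positivity) hr1, mul_assoc]
        congr 1
        have h3 : ((1 : ℝ) / 2) ^ s = (2 ^ s)⁻¹ := by
          rw [one_div, Real.inv_rpow (by norm_num)]
        have h4 : (2 : ℝ) ^ α' = 2 ^ α * 2 ^ s := by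
          rw [← Real.rpow_add (by norm_num)]; congr 1; simp only [hs]; ring
        have h5 : (2 : ℝ) ^ s - 1 ≠ 0 := by linarith
        have h6 : (2 : ℝ) ^ s ≠ 0 := by positivity
        rw [h3, h4]
        field_simp

/-- The sum over the blocks of length `1 / β` in `[1 / β, ∞)`. -/
theorem tsum_linear_blocks_le (hα : 0 < α) (hβ : 1 ≤ β) (hαα' : α < α') (hββ' : β < β') :
    ∑' n : ℕ, ENNReal.ofReal ((((n : ℝ) + 2) / β) ^ α' * Real.exp (-β' * (((n : ℝ) + 1) / β)) *
      (β ^ α * Real.exp ((n : ℝ) + 2))) ≤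
      ENNReal.ofReal (Real.exp 1 *
        ∑' n : ℕ, ((n : ℝ) + 1) ^ (α' + α) * Real.exp (-(n : ℝ) * (β' - β) / β)) := by
  have hβ0 : 0 < β := by linarith
  set f : ℕ → ℝ := fun n => ((n : ℝ) + 1) ^ (α' + α) * Real.exp (-(n : ℝ) * (β' - β) / β) with hf
  have hf0 : ∀ n, 0 ≤ f n := fun n => by simp only [hf]; positivity
  -- Block `n` matches term `n + 1` of the series in `constL`, and the term of index zero is spare.
  -- Since `1 ≤ β`, the powers of `β` cancel favourably.
  have hterm : ∀ n : ℕ, (((n : ℝ) + 2) / β) ^ α' * Real.exp (-β' * (((n : ℝ) + 1) / β)) *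
      (β ^ α * Real.exp ((n : ℝ) + 2)) ≤ Real.exp 1 * f (n + 1) := by
    intro n
    have h1 : (((n : ℝ) + 2) / β) ^ α' * β ^ α ≤ ((n : ℝ) + 2) ^ (α' + α) := by
      rw [Real.div_rpow (by positivity) hβ0.le, div_mul_eq_mul_div, mul_div_assoc]
      have h2 : β ^ α / β ^ α' ≤ 1 :=
        (div_le_one (by positivity)).2 (Real.rpow_le_rpow_of_exponent_le hβ hαα'.le)
      calc ((n : ℝ) + 2) ^ α' * (β ^ α / β ^ α') ≤ ((n : ℝ) + 2) ^ α' :=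
            mul_le_of_le_one_right (by positivity) h2
        _ ≤ ((n : ℝ) + 2) ^ (α' + α) :=
            Real.rpow_le_rpow_of_exponent_le (by linarith [n.cast_nonneg (α := ℝ)]) (by linarith)
    have h3 : Real.exp (-β' * (((n : ℝ) + 1) / β)) * Real.exp ((n : ℝ) + 2) =
        Real.exp 1 * Real.exp (-((n + 1 : ℕ) : ℝ) * (β' - β) / β) := by
      rw [← Real.exp_add, ← Real.exp_add]
      congr 1
      push_cast
      field_simp
      ring
    calc _ = ((((n : ℝ) + 2) / β) ^ α' * β ^ α) *
          (Real.exp (-β' * (((n : ℝ) + 1) / β)) * Real.exp ((n : ℝ) + 2)) := by ring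
      _ ≤ ((n : ℝ) + 2) ^ (α' + α) *
          (Real.exp 1 * Real.exp (-((n + 1 : ℕ) : ℝ) * (β' - β) / β)) := by
          rw [h3]; gcongr
      _ = _ := by
          simp only [hf]
          push_cast
          rw [show (n : ℝ) + 1 + 1 = n + 2 by ring]
          ring
  calc _ ≤ ∑' n : ℕ, ENNReal.ofReal (Real.exp 1) * ENNReal.ofReal (f (n + 1)) :=
        ENNReal.tsum_le_tsum fun n => by
          rw [← ENNReal.ofReal_mul (Real.exp_pos 1).le]
          exact ENNReal.ofReal_le_ofReal (hterm n)
    _ ≤ ENNReal.ofReal (Real.exp 1) * ∑' n : ℕ, ENNReal.ofReal (f n) := by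
        rw [ENNReal.tsum_mul_left]
        exact mul_le_mul' le_rfl (ENNReal.tsum_comp_le_tsum_of_injective (add_left_injective 1)
          fun n => ENNReal.ofReal (f n))
    _ = _ := by
        rw [← ENNReal.ofReal_tsum_of_nonneg hf0 (summable_constL_term hβ0 hββ'),
          ← ENNReal.ofReal_mul (Real.exp_pos 1).le]

theorem constL_pos (hαα' : α < α') : 0 < constL α α' β β' := by
  have h2s : 1 < (2 : ℝ) ^ (α' - α) := Real.one_lt_rpow (by norm_num) (by linarith)
  exact lt_max_of_lt_left (div_pos (by positivity) (by linarith))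

/-- An `L^k` majorant of the weighted field `Y - Z₀` on the whole domain. -/
theorem exists_majorant (hα : 0 < α) (hβ : 1 ≤ β) (hτ : τ ∈ Ioo (0 : ℝ) 1)
    (hμ : μ ∈ Ioo (0 : ℝ) 1) (hk : 4 * (τ⁻¹ + μ⁻¹) ≤ k)
    (hX : ∀ p ∈ domain, Measurable (X p.1 p.2)) (hC : incrementConst P k α β τ μ X < ∞)
    (hY : IsModification P X Y)
    (hYc : ∀ᵐ ω ∂P, ContinuousOn (fun p : ℝ × ℝ => Y p.1 p.2 ω) domain)
    (hαα' : α < α') (hββ' : β < β') (hZ₀ : Measurable Z₀)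
    (hbase : ∀ t, 0 < t → lpSize P k (fun ω => ‖X t 0 ω - Z₀ ω‖ₑ) ≤
      B * ENNReal.ofReal (max (t ^ (-α)) (β ^ α) * Real.exp (β * t))) :
    ∃ G : Ω → ℝ≥0∞, Measurable G ∧
      (∀ᵐ ω ∂P, ∀ p ∈ domain,
        ENNReal.ofReal (p.1 ^ α' * Real.exp (-β' * p.1) * |Y p.1 p.2 ω - Z₀ ω|) ≤ G ω) ∧
      lpSize P k G ≤ ENNReal.ofReal (1280 * constL α α' β β') *
        (B + incrementConst P k α β τ μ X) := by
  have hβ0 : 0 < β := by linarith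
  have hτ1 : 1 < τ⁻¹ := (one_lt_inv₀ hτ.1).2 hτ.2
  have hμ1 : 1 < μ⁻¹ := (one_lt_inv₀ hμ.1).2 hμ.2
  have hk1 : 1 ≤ k := by linarith
  have hβi : β⁻¹ ≤ 1 := inv_le_one_of_one_le₀ hβ
  have hpow1 : ∀ n : ℕ, ((1 : ℝ) / 2) ^ n ≤ 1 := fun n => pow_le_one₀ (by norm_num) (by norm_num)
  have hdle : ∀ n : ℕ, ((1 : ℝ) / 2) ^ n / β ≤ β⁻¹ := fun n => by
    rw [div_eq_mul_inv]
    exact mul_le_of_le_one_left (by positivity) (hpow1 n)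
  have hβd : ∀ n : ℕ, β * (((1 : ℝ) / 2) ^ n / β) ≤ 1 := fun n => by
    rw [mul_div_cancel₀ _ hβ0.ne']
    exact hpow1 n
  -- On these blocks `β t ≤ 1`: the exponential growth is at most `e`, the decaying weight is
  -- dropped, and the maximum in `hbase` is `t^(-α)`.
  obtain ⟨G₁, hG₁m, hG₁, hG₁s⟩ := exists_majorant_of_blocks (P := P) (α := α) (β := β) (α' := α')
    (β' := β') (B := B) hτ hμ hk hX hC hY hYc hZ₀
    (c := fun n => (1 / 2) ^ (n + 1) / β) (d := fun n => (1 / 2) ^ n / β)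
    (W := fun n => ((1 / 2) ^ (n + 1) / β) ^ (-α) * Real.exp 1)
    (w := fun n => ((1 / 2) ^ n / β) ^ α')
    (fun n => by positivity)
    (fun n => by
      have : (0 : ℝ) < (1 / 2) ^ n := by positivity
      rw [pow_succ]; gcongr; linarith)
    (fun n => by
      have : (0 : ℝ) ≤ (1 / 2) ^ (n + 1) / β := by positivity
      linarith [hdle n])
    (fun n t ht => (growth_le hα.le hβ0.le (by positivity) ht).trans (by
      gcongr; exact hβd n))
    (fun n t ht => by
      refine (weight_le (by linarith) (by linarith) (by positivity) ht).trans
        (mul_le_of_le_one_right (by positivity) (Real.exp_le_one_iff.2 ?_))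
      have : 0 ≤ β' * ((1 / 2) ^ (n + 1) / β) := mul_nonneg (by linarith) (by positivity)
      linarith)
    (fun n => (hbase _ (by positivity)).trans (by
      gcongr
      · exact max_le le_rfl (le_rpow_neg_of_le_inv hα.le hβ0 (by positivity) (hdle _))
      · exact hβd _))
  -- Here `t ≥ 1/β`, so `t^(-α) ≤ β^α` and the maximum in `hbase` is `β^α`; the block length `1/β`
  -- keeps `e^(β t)` within a factor `e`.
  obtain ⟨G₂, hG₂m, hG₂, hG₂s⟩ := exists_majorant_of_blocks (P := P) (α := α) (β := β) (α' := α')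
    (β' := β') (B := B) hτ hμ hk hX hC hY hYc hZ₀
    (c := fun n => ((n : ℝ) + 1) / β) (d := fun n => ((n : ℝ) + 2) / β)
    (W := fun n => β ^ α * Real.exp ((n : ℝ) + 2))
    (w := fun n => (((n : ℝ) + 2) / β) ^ α' * Real.exp (-β' * (((n : ℝ) + 1) / β)))
    (fun n => by positivity)
    (fun n => by gcongr; norm_num)
    (fun n => by
      have : ((n : ℝ) + 2) / β = ((n : ℝ) + 1) / β + β⁻¹ := by field_simp; ring
      linarith)
    (fun n t ht => (growth_le hα.le hβ0.le (by positivity) ht).trans (by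
      rw [mul_div_cancel₀ _ hβ0.ne']
      gcongr
      refine rpow_neg_le_of_inv_le hα.le hβ0 ?_
      rw [div_eq_mul_inv]
      exact le_mul_of_one_le_left (by positivity) (by linarith [n.cast_nonneg (α := ℝ)])))
    (fun n t ht => weight_le (by linarith) (by linarith) (by positivity) ht)
    (fun n => (hbase _ (by positivity)).trans (by
      rw [mul_div_cancel₀ _ hβ0.ne']
      gcongr
      · refine max_le (rpow_neg_le_of_inv_le hα.le hβ0 ?_) le_rfl
        rw [div_eq_mul_inv]
        exact le_mul_of_one_le_left (by positivity) (by linarith [n.cast_nonneg (α := ℝ)])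
      · norm_num))
  refine ⟨fun ω => G₁ ω + G₂ ω, hG₁m.add hG₂m, ?_, ?_⟩
  · filter_upwards [hG₁, hG₂] with ω h1 h2 p hp
    have hp1 : 0 < p.1 := hp.1
    rcases le_total (β * p.1) 1 with hle | hge
    · obtain ⟨n, hn1, hn2⟩ := exists_nat_pow_near_of_lt_one (mul_pos hβ0 hp1) hle
        (by norm_num : (0 : ℝ) < 1 / 2) (by norm_num)
      refine (h1 n p ⟨⟨?_, ?_⟩, hp.2⟩).trans le_self_add
      · rw [div_le_iff₀ hβ0]; linarith
      · rw [le_div_iff₀ hβ0]; linarith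
    · have hfl : 1 ≤ ⌊β * p.1⌋₊ := Nat.le_floor (by simpa using hge)
      have hn1 := Nat.floor_le (mul_pos hβ0 hp1).le
      have hn2 := Nat.lt_floor_add_one (β * p.1)
      obtain ⟨n, hn⟩ := Nat.exists_eq_add_of_le' hfl
      rw [hn] at hn1 hn2
      push_cast at hn1 hn2
      refine (h2 n p ⟨⟨?_, ?_⟩, hp.2⟩).trans le_add_self
      · rw [div_le_iff₀ hβ0]; linarith
      · rw [le_div_iff₀ hβ0]; linarith
  · set C := incrementConst P k α β τ μ X
    set L := constL α α' β β' with hL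
    have hL0 : 0 < L := constL_pos hαα'
    have e1 : lpSize P k G₁ ≤ (B + 128 * C) * ENNReal.ofReal (Real.exp 1 * L) :=
      hG₁s.trans (mul_le_mul' le_rfl ((tsum_dyadic_blocks_le hβ hαα').trans
        (ENNReal.ofReal_le_ofReal (mul_le_mul_of_nonneg_left (le_max_left _ _)
          (Real.exp_pos 1).le))))
    have e2 : lpSize P k G₂ ≤ (B + 128 * C) * ENNReal.ofReal (Real.exp 1 * L) :=
      hG₂s.trans (mul_le_mul' le_rfl ((tsum_linear_blocks_le hα hβ hαα' hββ').trans
        (ENNReal.ofReal_le_ofReal (mul_le_mul_of_nonneg_left (le_max_right _ _)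
          (Real.exp_pos 1).le))))
    calc lpSize P k (fun ω => G₁ ω + G₂ ω)
        ≤ (B + 128 * C) * ENNReal.ofReal (Real.exp 1 * L) +
          (B + 128 * C) * ENNReal.ofReal (Real.exp 1 * L) :=
          (lpSize_add_le hk1 hG₁m hG₂m).trans (add_le_add e1 e2)
      _ = (B + 128 * C) * ENNReal.ofReal (2 * (Real.exp 1 * L)) := by
          rw [ENNReal.ofReal_mul (p := 2) (by norm_num), ENNReal.ofReal_ofNat]; ring
      -- The constant `1280 = 128 * 10` comes from `B ≤ 128 B` and `2e ≤ 10`.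
      _ ≤ (128 * (B + C)) * ENNReal.ofReal (10 * L) := by
          gcongr ?_ * ENNReal.ofReal ?_
          · rw [mul_add]
            gcongr
            exact le_mul_of_one_le_left zero_le (by norm_num)
          · nlinarith [Real.exp_one_lt_d9]
      _ = ENNReal.ofReal (1280 * L) * (B + C) := by
          rw [show 1280 * L = 128 * (10 * L) by ring, ENNReal.ofReal_mul (p := 128) (by norm_num),
            ENNReal.ofReal_ofNat]
          ring

end Majorant

/-! ### Reference values along `x = 0` and bounds on the weight. -/

section Base

variable {Ω : Type*} [MeasurableSpace Ω] {P : Measure Ω} {α β τ μ k : ℝ} {X : ℝ → ℝ → Ω → ℝ}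

theorem incSize_time_step_le (hk : 1 ≤ k) (hτ : 0 < τ) (hμ : 0 < μ)
    (hX : ∀ p ∈ domain, Measurable (X p.1 p.2)) (hC : incrementConst P k α β τ μ X < ∞)
    {t ε : ℝ} (ht : 0 < t) (hε : ε ∈ Ico (0 : ℝ) 1) :
    incSize P k X (t + ε, 0) (t, 0) ≤
      incrementConst P k α β τ μ X * ENNReal.ofReal (growth α β t) := by
  refine (incSize_le_of_le (α := α) (β := β) hk hτ hμ hX hC ht hε le_rfl le_rfl zero_le_one
    (Or.inl one_pos)).trans ?_
  gcongr
  refine mul_le_of_le_one_right (growth_pos α β ht).le (max_le ?_ ?_)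
  · exact Real.rpow_le_one hε.1 hε.2.le hτ.le
  · simp [Real.zero_rpow hμ.ne']

theorem growth_le_exp (hα : 0 ≤ α) {t : ℝ} (ht : 1 ≤ t) : growth α β t ≤ Real.exp (β * t) :=
  mul_le_of_le_one_left (Real.exp_pos _).le (Real.rpow_le_one_of_one_le_of_nonpos ht (by linarith))

/-- Walk back to time one in steps of `1/2`. The constant `2` reproduces itself: `2 + 1 ≤ 2
e^(β/2)`, since `e^(β/2) ≥ 1 + β/2 ≥ 3/2`. -/
theorem incSize_one_le_of_one_le (hα : 0 ≤ α) (hβ : 1 ≤ β) (hk : 1 ≤ k) (hτ : 0 < τ) (hμ : 0 < μ)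
    (hX : ∀ p ∈ domain, Measurable (X p.1 p.2)) (hC : incrementConst P k α β τ μ X < ∞) (n : ℕ) :
    ∀ t : ℝ, 1 ≤ t → t ≤ 1 + n / 2 → incSize P k X (t, 0) (1, 0) ≤
      incrementConst P k α β τ μ X * ENNReal.ofReal (2 * Real.exp (β * t)) := by
  have hdom : ∀ {t : ℝ}, 0 < t → (t, (0 : ℝ)) ∈ domain := fun ht => ⟨ht, by simp⟩
  induction n with
  | zero =>
    intro t h1 h2
    obtain rfl : t = 1 := le_antisymm (by simpa using h2) h1
    rw [incSize_self (by linarith)]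
    exact zero_le
  | succ n ih =>
    intro t h1 h2
    push_cast at h2
    by_cases h3 : t ≤ 3 / 2
    · have e := incSize_time_step_le (P := P) (α := α) (β := β) hk hτ hμ hX hC (t := 1) (ε := t - 1)
        one_pos ⟨by linarith, by linarith⟩
      rw [add_sub_cancel] at e
      refine e.trans ?_
      gcongr
      refine (growth_le_exp hα le_rfl).trans ?_
      have : Real.exp (β * 1) ≤ Real.exp (β * t) := Real.exp_le_exp.2 (by nlinarith)
      linarith [Real.exp_pos (β * t)]
    · have e1 := incSize_time_step_le (P := P) (α := α) (β := β) hk hτ hμ hX hC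
        (t := t - 1 / 2) (ε := 1 / 2) (by linarith) ⟨by norm_num, by norm_num⟩
      rw [sub_add_cancel] at e1
      have e2 := ih (t - 1 / 2) (by linarith) (by linarith)
      refine (incSize_triangle hk hX (hdom (by linarith)) (hdom (t := t - 1 / 2) (by linarith))
        (hdom one_pos)).trans ((add_le_add e1 e2).trans ?_)
      rw [← mul_add, ← ENNReal.ofReal_add (growth_pos α β (by linarith)).le (by positivity)]
      gcongr
      have h4 := growth_le_exp (β := β) hα (by linarith : 1 ≤ t - 1 / 2)
      have h5 : Real.exp (β * t) = Real.exp (β * (t - 1 / 2)) * Real.exp (β / 2) := by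
        rw [← Real.exp_add]; congr 1; ring
      have h6 : 3 / 2 ≤ Real.exp (β / 2) := by linarith [Real.add_one_le_exp (β / 2)]
      rw [h5]
      nlinarith [Real.exp_pos (β * (t - 1 / 2))]

/-- Gives `hbase` of `exists_majorant` with `Z₀ = X 1 0` and `B = 2C`, with no moment assumption on
`X` itself. -/
theorem incSize_one_le (hα : 0 < α) (hβ : 1 ≤ β) (hk : 1 ≤ k) (hτ : 0 < τ) (hμ : 0 < μ)
    (hX : ∀ p ∈ domain, Measurable (X p.1 p.2)) (hC : incrementConst P k α β τ μ X < ∞)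
    {t : ℝ} (ht : 0 < t) :
    incSize P k X (t, 0) (1, 0) ≤ 2 * incrementConst P k α β τ μ X *
      ENNReal.ofReal (max (t ^ (-α)) (β ^ α) * Real.exp (β * t)) := by
  rcases le_total t 1 with h | h
  · have e := incSize_time_step_le (P := P) (α := α) (β := β) hk hτ hμ hX hC (ε := 1 - t) ht
      ⟨by linarith, by linarith⟩
    rw [add_sub_cancel, incSize_comm] at e
    refine e.trans ?_
    gcongr
    · exact le_mul_of_one_le_left zero_le (by norm_num)
    · unfold growth
      gcongr
      exact le_max_left _ _
  · obtain ⟨n, hn⟩ := exists_nat_ge (2 * (t - 1))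
    refine (incSize_one_le_of_one_le hα.le hβ hk hτ hμ hX hC n t h (by linarith)).trans ?_
    rw [ENNReal.ofReal_mul (by norm_num), ENNReal.ofReal_ofNat, ← mul_assoc, mul_comm _ 2]
    gcongr
    exact le_mul_of_one_le_left (Real.exp_pos _).le
      (le_max_of_le_right (Real.one_le_rpow hβ hα.le))

theorem lpSize_le_momentNorm (hk : 0 < k) {t x : ℝ} (ht : 0 < t) (hx : x ∈ Icc (0 : ℝ) 1) :
    lpSize P k (fun ω => ‖X t x ω‖ₑ) ≤
      momentNorm P k α β X * ENNReal.ofReal (growth α β t) := by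
  have h1 : ENNReal.ofReal (t ^ α * Real.exp (-β * t)) * eLpNorm (X t x) (ENNReal.ofReal k) P ≤
      momentNorm P k α β X :=
    le_iSup₂_of_le (f := fun (p : ℝ × ℝ) (_ : p ∈ domain) =>
      ENNReal.ofReal (p.1 ^ α * Real.exp (-β * p.1)) *
        eLpNorm (X p.1 p.2) (ENNReal.ofReal k) P) (t, x) ⟨ht, hx⟩ le_rfl
  rw [eLpNorm_eq_lpSize hk] at h1
  have h2 : ENNReal.ofReal (growth α β t) * ENNReal.ofReal (t ^ α * Real.exp (-β * t)) = 1 := by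
    rw [← ENNReal.ofReal_mul (growth_pos α β ht).le, growth_mul_weight α β ht, ENNReal.ofReal_one]
  calc lpSize P k (fun ω => ‖X t x ω‖ₑ)
      = ENNReal.ofReal (growth α β t) * (ENNReal.ofReal (t ^ α * Real.exp (-β * t)) *
          lpSize P k (fun ω => ‖X t x ω‖ₑ)) := by rw [← mul_assoc, h2, one_mul]
    _ ≤ ENNReal.ofReal (growth α β t) * momentNorm P k α β X := mul_le_mul' le_rfl h1
    _ = _ := mul_comm _ _

/-- Apply `u ≤ e^u` with `u = β' t / α'` and raise to the power `α'`. -/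
theorem weight_le_const {α' β' : ℝ} (hα' : 0 < α') (hβ' : 0 < β') {t : ℝ} (ht : 0 < t) :
    t ^ α' * Real.exp (-β' * t) ≤ (α' / β') ^ α' := by
  have h1 : t ≤ α' / β' * Real.exp (β' * t / α') := by
    have h2 := Real.add_one_le_exp (β' * t / α')
    calc t = α' / β' * (β' * t / α') := by field_simp
      _ ≤ _ := by gcongr; linarith
  have h3 : t ^ α' ≤ (α' / β') ^ α' * Real.exp (β' * t) := by
    refine (Real.rpow_le_rpow ht.le h1 hα'.le).trans (le_of_eq ?_)
    rw [Real.mul_rpow (by positivity) (by positivity), ← Real.exp_mul,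
      div_mul_cancel₀ _ hα'.ne']
  calc t ^ α' * Real.exp (-β' * t) ≤ (α' / β') ^ α' * Real.exp (β' * t) * Real.exp (-β' * t) := by
        gcongr
    _ = _ := by rw [mul_assoc, ← Real.exp_add]; simp

end Base

end SpaceTimeField

/-! ### Conclusion. -/

theorem proposition2p1 {Ω : Type*} [MeasurableSpace Ω] (P : Measure Ω) [IsProbabilityMeasure P]
    (α β τ μ k : ℝ) (hα : 0 < α) (hβ : 1 ≤ β) (hτ : τ ∈ Ioo (0 : ℝ) 1) (hμ : μ ∈ Ioo (0 : ℝ) 1)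
    (hk : 4 * (τ⁻¹ + μ⁻¹) ≤ k)
    (X : ℝ → ℝ → Ω → ℝ)
    (hX : ∀ p ∈ SpaceTimeField.domain, Measurable (X p.1 p.2))
    (hC : SpaceTimeField.incrementConst P k α β τ μ X < ∞) :
    -- `X` has a modification all of whose sample functions are continuous on `𝒟(∞)`
    (∃ Y : ℝ → ℝ → Ω → ℝ,
      (∀ p ∈ SpaceTimeField.domain, Measurable (Y p.1 p.2)) ∧
      SpaceTimeField.IsModification P X Y ∧
      ∀ ω, ContinuousOn (fun p : ℝ × ℝ => Y p.1 p.2 ω) SpaceTimeField.domain) ∧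
    -- every a.s. continuous modification (`X` itself, if it is a.s. continuous) obeys the bound
    ∀ Y : ℝ → ℝ → Ω → ℝ, SpaceTimeField.IsModification P X Y →
      (∀ᵐ ω ∂P, ContinuousOn (fun p : ℝ × ℝ => Y p.1 p.2 ω) SpaceTimeField.domain) →
      ∀ α' β' : ℝ, α < α' → β < β' →
        (∀ᵐ ω ∂P, SpaceTimeField.MemWeightedC α' β' (fun t x => Y t x ω)) ∧
        ∫⁻ ω, SpaceTimeField.weightedSupNorm α' β' (fun t x => Y t x ω) ^ k ∂P ≤
          ENNReal.ofReal (1280 * SpaceTimeField.constL α α' β β') ^ k *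
            (SpaceTimeField.momentNorm P k α β X +
              SpaceTimeField.incrementConst P k α β τ μ X) ^ k := by
  open SpaceTimeField in
  have hτ1 : 1 < τ⁻¹ := (one_lt_inv₀ hτ.1).2 hτ.2
  have hμ1 : 1 < μ⁻¹ := (one_lt_inv₀ hμ.1).2 hμ.2
  have hk1 : 1 ≤ k := by linarith
  have hk0 : 0 < k := by linarith
  refine ⟨exists_continuous_modification hα hβ hτ hμ hk hX hC,
    fun Y hY hYc α' β' hαα' hββ' => ⟨?_, ?_⟩⟩
  -- Subtracting `X 1 0` gives a majorant of finite `L^k` size from `hC` alone; the subtracted value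
  -- is finite and the weight is bounded.
  · have h10 : ((1 : ℝ), (0 : ℝ)) ∈ domain := ⟨show (0 : ℝ) < 1 from one_pos, by simp⟩
    obtain ⟨G, hGm, hG, hGs⟩ := exists_majorant (P := P) (Z₀ := X 1 0) hα hβ hτ hμ hk hX hC hY hYc
      hαα' hββ' (hX (1, 0) h10) fun t ht => incSize_one_le hα hβ hk1 hτ.1 hμ.1 hX hC ht
    have hfin : lpSize P k G < ∞ := hGs.trans_lt (ENNReal.mul_lt_top ENNReal.ofReal_lt_top
      (ENNReal.add_lt_top.2 ⟨ENNReal.mul_lt_top (by norm_num) hC, hC⟩))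
    filter_upwards [hYc, hG, ae_lt_top_of_lpSize hk0 hGm hfin] with ω h1 h2 h3
    refine ⟨h1, lt_of_le_of_lt (iSup₂_le fun p hp => ?_) (ENNReal.add_lt_top.2
      ⟨h3, ENNReal.ofReal_lt_top (r := (α' / β') ^ α' * |X 1 0 ω|)⟩)⟩
    have hp1 : 0 < p.1 := hp.1
    have hw : 0 ≤ p.1 ^ α' * Real.exp (-β' * p.1) := by positivity
    refine le_trans ?_ (add_le_add (h2 p hp) le_rfl)
    rw [← ENNReal.ofReal_add (by positivity)
      (mul_nonneg (Real.rpow_nonneg (div_nonneg (by linarith) (by linarith)) _) (abs_nonneg _))]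
    refine ENNReal.ofReal_le_ofReal ?_
    calc p.1 ^ α' * Real.exp (-β' * p.1) * |Y p.1 p.2 ω|
        ≤ p.1 ^ α' * Real.exp (-β' * p.1) * (|Y p.1 p.2 ω - X 1 0 ω| + |X 1 0 ω|) := by
          gcongr
          simpa using abs_add_le (Y p.1 p.2 ω - X 1 0 ω) (X 1 0 ω)
      _ ≤ _ := by
          rw [mul_add]
          gcongr
          exact weight_le_const (by linarith) (by linarith) hp1
  · obtain ⟨G, hGm, hG, hGs⟩ := exists_majorant (P := P) (Z₀ := fun _ => 0)
      (B := momentNorm P k α β X) hα hβ hτ hμ hk hX hC hY hYc hαα' hββ' measurable_const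
      fun t ht => by
        simp only [sub_zero]
        refine (lpSize_le_momentNorm (α := α) (β := β) hk0 ht (by simp)).trans ?_
        unfold growth
        gcongr
        exact le_max_left _ _
    -- The supremum norm need not be measurable in `ω`; monotonicity of the lower integral against
    -- the measurable majorant `G` is enough.
    rw [← ENNReal.mul_rpow_of_nonneg _ _ hk0.le]
    refine le_trans (lintegral_mono_ae ?_) (lintegral_rpow_le_of_lpSize_le hk0 hGs)
    filter_upwards [hG] with ω h
    refine ENNReal.rpow_le_rpow (iSup₂_le fun p hp => ?_) hk0.le
    simpa using h p hp
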